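/- **Conventions.** Let $\Gamma$ be an abelian group (for example $\mathbb Z$, $\mathbb R$ or $\mathbb Z/n\mathbb Z$), and let $H_1(X)=H_1(X;\Gamma)$ denote the first singular homology group of $X$ with coefficients in $\Gamma$. *Area extensions.* An area extension of a metric space $X$ is a metric space $X'$ with an isometric embedding $\iota:X\to X'$ such that each connected component of $X'\setminus\iota(X)$ is homeomorphic to the open disc $\{x\in\mathbb R^2: |x|<1\}$ or to the open cylinder $\{x\in\mathbb R^2: 1<|x|<2\}$. Its excess area is the sum of the $2$-dimensional Hausdorff measures of these components, where $$\mathcal H^2(M)=\lim_{\delta\to0}\inf\Big\{\sum_i \operatorname{diam}(U_i)^2 : M=\bigcup_i U_i \text{ a countable cover},\ \operatorname{diam}(U_i)<\delta\Big\}.$$ *The groups $H_d$ and $\hat H_d$.* For $b,c\in H_1(X)$ let $d_1(b,c)\in[0,\infty]$ be the infimum of the excess areas of all area extensions $(X',\iota)$ of $X$ with $\iota_*b=\iota_*c$ in $H_1(X')$. If $X$ is complete, then $d_1$ is a translation-invariant (extended) pseudo-metric on $H_1(X)$. Let $H_d(X)$ be the quotient group of $H_1(X)$ obtained by identifying classes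 at $d_1$-distance $0$, and let $\hat H_d(X)$ be the completion of $H_d(X)$ with respect to $d_1$, with the induced addition. **Corollary.** Let $G$ be a locally finite $1$-complex (a CW complex of dimension at most $1$ in which every point has a neighbourhood meeting only finitely many closed cells), and let $\rho$ be the path metric on $G$ in which every edge has length $1$ and is traversed at constant speed by its characteristic map ($\rho=\infty$ between different components). Let $G$ be equipped with $\rho$ itself, if $G$ is connected, or more generally with any metric $d$ inducing the topology of $G$ for which the identity $(G,d)\to(G,\rho)$ is uniformly continuous (for instance, any metric inducing the topology if $G$ is finite). Then $G$ is complete, and the canonical homomorphism $H_1(G)\to\hat H_d(G)$ is an isomorphism of groups; in particular $$\hat H_d(G)\cong H_1(G).$$ -/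

import Mathlib

open Set Topology MeasureTheory CategoryTheory
open scoped ENNReal

universe u

noncomputable section

namespace LengthHomology

/-! ### First singular homology -/

/-- The first singular homology group `H₁(X; Γ)` of a topological space `X` with coefficients in
the abelian group `Γ`. -/
def H1 (X : Type u) [TopologicalSpace X] (Γ : Type u) [AddCommGroup Γ] : Type u :=
  ((AlgebraicTopology.singularHomologyFunctor AddCommGrpCat.{u} 1).obj (AddCommGrpCat.of Γ)).obj
    (TopCat.of X)

instance (X : Type u) [TopologicalSpace X] (Γ : Type u) [AddCommGroup Γ] :
    AddCommGroup (H1 X Γ) :=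
  inferInstanceAs (AddCommGroup
    (((AlgebraicTopology.singularHomologyFunctor AddCommGrpCat.{u} 1).obj
      (AddCommGrpCat.of Γ)).obj (TopCat.of X)))

/-- The homomorphism `H₁(X; Γ) → H₁(Y; Γ)` induced by a continuous map `f : X → Y`. -/
def H1.map {X Y : Type u} [TopologicalSpace X] [TopologicalSpace Y] (Γ : Type u) [AddCommGroup Γ]
    (f : C(X, Y)) : H1 X Γ →+ H1 Y Γ :=
  (((AlgebraicTopology.singularHomologyFunctor AddCommGrpCat.{u} 1).obj
    (AddCommGrpCat.of Γ)).map (TopCat.ofHom f)).hom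

lemma H1.map_id_apply {X : Type u} [TopologicalSpace X] (Γ : Type u) [AddCommGroup Γ]
    (c : H1 X Γ) : H1.map Γ (ContinuousMap.id X) c = c := by
  have h := ((AlgebraicTopology.singularHomologyFunctor AddCommGrpCat.{u} 1).obj
    (AddCommGrpCat.of Γ)).map_id (TopCat.of X)
  exact congrArg (fun φ => AddCommGrpCat.Hom.hom φ c) h

lemma H1.map_comp_apply {X Y Z : Type u} [TopologicalSpace X] [TopologicalSpace Y]
    [TopologicalSpace Z] (Γ : Type u) [AddCommGroup Γ] (g : C(Y, Z)) (f : C(X, Y)) (c : H1 X Γ) :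
    H1.map Γ (g.comp f) c = H1.map Γ g (H1.map Γ f c) := by
  have h := ((AlgebraicTopology.singularHomologyFunctor AddCommGrpCat.{u} 1).obj
    (AddCommGrpCat.of Γ)).map_comp (TopCat.ofHom f) (TopCat.ofHom g)
  exact congrArg (fun φ => AddCommGrpCat.Hom.hom φ c) h

lemma H1.subsingleton_of_isEmpty (X : Type u) [TopologicalSpace X] [IsEmpty X] (Γ : Type u)
    [AddCommGroup Γ] : Subsingleton (H1 X Γ) := by
  have : IsEmpty (TopCat.of X) := ‹IsEmpty X›
  have h := AlgebraicTopology.isZero_singularHomologyFunctor_of_totallyDisconnectedSpace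
    AddCommGrpCat.{u} 1 (AddCommGrpCat.of Γ) (TopCat.of X) one_ne_zero
  exact AddCommGrpCat.subsingleton_of_isZero h

/-! ### Area extensions -/

/-- The two-dimensional Hausdorff measure of a subset of a metric space, i.e. the limit for
`δ → 0` of the infimum of `∑ diam(Uᵢ)²` over the countable covers by sets of diameter at most
`δ`. -/
def area {Y : Type u} [MetricSpace Y] (s : Set Y) : ℝ≥0∞ :=
  letI : MeasurableSpace Y := borel Y
  haveI : BorelSpace Y := ⟨rfl⟩
  Measure.hausdorffMeasure 2 s

/-- The open unit disc in the plane. -/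
abbrev OpenDisc : Set (EuclideanSpace ℝ (Fin 2)) := {x | ‖x‖ < 1}

/-- The open annulus `1 < |x| < 2` in the plane (an open cylinder). -/
abbrev OpenCylinder : Set (EuclideanSpace ℝ (Fin 2)) := {x | 1 < ‖x‖ ∧ ‖x‖ < 2}

/-- The connected components of a subspace `U` of a topological space. -/
def components {Y : Type u} [TopologicalSpace Y] (U : Set Y) : Set (Set Y) :=
  {D | ∃ p ∈ U, D = connectedComponentIn U p}

/-- An area extension of the metric space `X`: a metric space `carrier` in which `X` is embedded
by an isometry `ι`, such that each component of the complement of `ι(X)` is homeomorphic to an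
open disc or to an open cylinder. -/
structure AreaExtension (X : Type u) [MetricSpace X] where
  carrier : Type u
  [metric : MetricSpace carrier]
  ι : X → carrier
  isometry_ι : Isometry ι
  disc_or_cylinder : ∀ D ∈ components (range ι)ᶜ,
    Nonempty (D ≃ₜ OpenDisc) ∨ Nonempty (D ≃ₜ OpenCylinder)

attribute [instance] AreaExtension.metric

namespace AreaExtension

variable {X : Type u} [MetricSpace X]

/-- The excess area: the sum of the areas of the components of the complement of `X`. -/
def excessArea (E : AreaExtension X) : ℝ≥0∞ :=
  ∑' D : components (range E.ι)ᶜ, area (D : Set E.carrier)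

/-- The homomorphism `H₁(X; Γ) → H₁(X'; Γ)` induced by the embedding of `X` in its area
extension `X'`. -/
def h1Map (E : AreaExtension X) (Γ : Type u) [AddCommGroup Γ] : H1 X Γ →+ H1 E.carrier Γ :=
  H1.map Γ ⟨E.ι, E.isometry_ι.continuous⟩

/-- The trivial area extension, with nothing added. -/
def trivial (X : Type u) [MetricSpace X] : AreaExtension X where
  carrier := X
  ι := id
  isometry_ι := isometry_id
  disc_or_cylinder := by
    rintro D ⟨p, hp, -⟩
    simp at hp

lemma excessArea_trivial : (trivial X).excessArea = 0 := by
  unfold excessArea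
  refine ENNReal.tsum_eq_zero.2 ?_
  rintro ⟨D, p, hp, -⟩
  exact absurd (mem_range_self (f := (trivial X).ι) p) hp

end AreaExtension

lemma area_image {Y Z : Type u} [MetricSpace Y] [MetricSpace Z] {i : Y → Z} (hi : Isometry i)
    (s : Set Y) : area (i '' s) = area s := by
  let : MeasurableSpace Y := borel Y
  have : BorelSpace Y := ⟨rfl⟩
  let : MeasurableSpace Z := borel Z
  have : BorelSpace Z := ⟨rfl⟩
  exact hi.hausdorffMeasure_image (Or.inl (by norm_num)) s

/-- If `L` is a clopen part of `Sᶜ` which lies in the isometric image of `Y`, then the component in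
`Sᶜ` of a point of `L` is the image of the component in `i⁻¹(Sᶜ)`. -/
lemma connectedComponentIn_image {Y Z : Type u} [MetricSpace Y] [MetricSpace Z] {i : Y → Z}
    (hi : Isometry i) {S L R : Set Z} (hL : IsOpen L) (hR : IsOpen R) (hLR : Disjoint L R)
    (hS : Sᶜ ⊆ L ∪ R) (hLi : L ⊆ range i) {p : Y} (hpS : i p ∉ S) (hpL : i p ∈ L) :
    connectedComponentIn Sᶜ (i p) = i '' connectedComponentIn (i ⁻¹' S)ᶜ p := by
  apply subset_antisymm
  · set K := connectedComponentIn Sᶜ (i p) with hK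
    have hKL : K ⊆ L := by
      refine isPreconnected_connectedComponentIn.subset_left_of_subset_union hL hR hLR
        ((connectedComponentIn_subset _ _).trans hS) ⟨i p, mem_connectedComponentIn hpS, hpL⟩
    have hKi : i '' (i ⁻¹' K) = K := image_preimage_eq_of_subset (hKL.trans hLi)
    have hpre : IsPreconnected (i ⁻¹' K) := by
      rw [← hi.isEmbedding.isInducing.isPreconnected_image, hKi]
      exact isPreconnected_connectedComponentIn
    rw [← hKi]
    refine image_mono (hpre.subset_connectedComponentIn (mem_connectedComponentIn hpS) ?_)
    intro y hy
    exact connectedComponentIn_subset Sᶜ (i p) (mem_preimage.1 hy)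
  · refine IsPreconnected.subset_connectedComponentIn
      (isPreconnected_connectedComponentIn.image _ hi.continuous.continuousOn)
      ⟨p, mem_connectedComponentIn hpS, rfl⟩ ?_
    rintro _ ⟨y, hy, rfl⟩
    exact connectedComponentIn_subset (i ⁻¹' S)ᶜ p hy

/-- Two area extensions of a complete metric space can be united to one area extension. -/
lemma AreaExtension.exists_glue {X : Type u} [MetricSpace X] [CompleteSpace X] [Nonempty X]
    (Γ : Type u) [AddCommGroup Γ] (E F : AreaExtension X) : ∃ G : AreaExtension X,
      (∀ c d, E.h1Map Γ c = E.h1Map Γ d → G.h1Map Γ c = G.h1Map Γ d) ∧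
      (∀ c d, F.h1Map Γ c = F.h1Map Γ d → G.h1Map Γ c = G.h1Map Γ d) ∧
      G.excessArea ≤ E.excessArea + F.excessArea := by
  set i := Metric.toGlueL E.isometry_ι F.isometry_ι with hidef
  set j := Metric.toGlueR E.isometry_ι F.isometry_ι with hjdef
  have hi : Isometry i := Metric.toGlueL_isometry _ _
  have hj : Isometry j := Metric.toGlueR_isometry _ _
  have hcomm : i ∘ E.ι = j ∘ F.ι := Metric.toGlue_commute _ _
  have hE : IsClosed (range E.ι) := E.isometry_ι.isClosedEmbedding.isClosed_range
  have hF : IsClosed (range F.ι) := F.isometry_ι.isClosedEmbedding.isClosed_range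
  have hdist : ∀ x y, dist (i x) (j y) = (⨅ p, dist x (E.ι p) + dist y (F.ι p)) + 0 :=
    fun x y => rfl
  have hdist1 : ∀ x y, Metric.infDist x (range E.ι) ≤ dist (i x) (j y) := by
    intro x y
    rw [hdist, add_zero]
    refine le_ciInf fun p => ?_
    exact (Metric.infDist_le_dist_of_mem (mem_range_self p)).trans
      (le_add_of_nonneg_right dist_nonneg)
  have hdist2 : ∀ x y, Metric.infDist y (range F.ι) ≤ dist (i x) (j y) := by
    intro x y
    rw [hdist, add_zero]
    refine le_ciInf fun p => ?_
    exact (Metric.infDist_le_dist_of_mem (mem_range_self p)).trans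
      (le_add_of_nonneg_left dist_nonneg)
  have hcover : ∀ z, z ∈ range i ∪ range j := by
    intro z
    induction z using Quotient.inductionOn' with
    | h z =>
      cases z with
      | inl x => exact Or.inl ⟨x, rfl⟩
      | inr y => exact Or.inr ⟨y, rfl⟩
  have hposE : ∀ x, x ∉ range E.ι → 0 < Metric.infDist x (range E.ι) := fun x hx =>
    (hE.notMem_iff_infDist_pos (range_nonempty _)).1 hx
  have hposF : ∀ y, y ∉ range F.ι → 0 < Metric.infDist y (range F.ι) := fun y hy =>
    (hF.notMem_iff_infDist_pos (range_nonempty _)).1 hy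
  have hL : IsOpen (range j)ᶜ := by
    rw [Metric.isOpen_iff]
    intro z hz
    obtain ⟨x, rfl⟩ := (hcover z).resolve_right hz
    have hx : x ∉ range E.ι := by
      rintro ⟨p, rfl⟩
      exact hz ⟨F.ι p, (congrFun hcomm p).symm⟩
    refine ⟨_, hposE x hx, ?_⟩
    rintro w hw ⟨y, rfl⟩
    rw [Metric.mem_ball, dist_comm] at hw
    exact absurd (hdist1 x y) (not_le.2 hw)
  have hR : IsOpen (range i)ᶜ := by
    rw [Metric.isOpen_iff]
    intro z hz
    obtain ⟨y, rfl⟩ := (hcover z).resolve_left hz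
    have hy : y ∉ range F.ι := by
      rintro ⟨p, rfl⟩
      exact hz ⟨E.ι p, congrFun hcomm p⟩
    refine ⟨_, hposF y hy, ?_⟩
    rintro w hw ⟨x, rfl⟩
    rw [Metric.mem_ball] at hw
    exact absurd (hdist2 x y) (not_le.2 hw)
  set S := range (i ∘ E.ι) with hSdef
  have hSi : i ⁻¹' S = range E.ι := by
    rw [hSdef, range_comp, preimage_image_eq _ hi.injective]
  have hSj : j ⁻¹' S = range F.ι := by
    rw [hSdef, hcomm, range_comp, preimage_image_eq _ hj.injective]
  have hLi : (range j)ᶜ ⊆ range i := fun z hz => (hcover z).resolve_right hz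
  have hRj : (range i)ᶜ ⊆ range j := fun z hz => (hcover z).resolve_left hz
  have hLR : Disjoint (range j)ᶜ (range i)ᶜ := by
    rw [disjoint_left]
    intro z h1 h2
    exact h2 (hLi h1)
  have hEj : ∀ x, x ∉ range E.ι → i x ∈ (range j)ᶜ := by
    rintro x hx ⟨y, hy⟩
    have h1 := hdist1 x y
    rw [hy, dist_self] at h1
    exact absurd (hposE x hx) (not_lt.2 h1)
  have hFi : ∀ y, y ∉ range F.ι → j y ∈ (range i)ᶜ := by
    rintro y hy ⟨x, hx⟩
    have h1 := hdist2 x y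
    rw [hx, dist_self] at h1
    exact absurd (hposF y hy) (not_lt.2 h1)
  have hS : Sᶜ ⊆ (range j)ᶜ ∪ (range i)ᶜ := by
    intro z hz
    rcases hcover z with ⟨x, rfl⟩ | ⟨y, rfl⟩
    · exact Or.inl (hEj x (fun h => hz (by rw [← mem_preimage, hSi]; exact h)))
    · exact Or.inr (hFi y (fun h => hz (by rw [← mem_preimage, hSj]; exact h)))
  have hcomp : components Sᶜ ⊆
      (image i '' components (range E.ι)ᶜ) ∪ (image j '' components (range F.ι)ᶜ) := by
    rintro D ⟨z, hz, rfl⟩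
    rcases hcover z with ⟨x, rfl⟩ | ⟨y, rfl⟩
    · left
      have hx : x ∉ range E.ι := fun h => hz (by rw [← mem_preimage, hSi]; exact h)
      refine ⟨_, ⟨x, hx, rfl⟩, ?_⟩
      rw [connectedComponentIn_image hi hL hR hLR hS hLi hz (hEj x hx), hSi]
    · right
      have hy : y ∉ range F.ι := fun h => hz (by rw [← mem_preimage, hSj]; exact h)
      refine ⟨_, ⟨y, hy, rfl⟩, ?_⟩
      rw [connectedComponentIn_image hj hR hL hLR.symm (by rwa [union_comm]) hRj hz (hFi y hy),
        hSj]
  refine ⟨{ carrier := Metric.GlueSpace E.isometry_ι F.isometry_ι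
            ι := i ∘ E.ι
            isometry_ι := hi.comp E.isometry_ι
            disc_or_cylinder := ?_ }, ?_, ?_, ?_⟩
  · intro D hD
    rcases hcomp hD with ⟨D', hD', rfl⟩ | ⟨D', hD', rfl⟩
    · have e : D' ≃ₜ (i '' D' : Set _) := hi.isEmbedding.homeomorphImage D'
      exact (E.disc_or_cylinder D' hD').imp (fun ⟨f⟩ => ⟨e.symm.trans f⟩)
        (fun ⟨f⟩ => ⟨e.symm.trans f⟩)
    · have e : D' ≃ₜ (j '' D' : Set _) := hj.isEmbedding.homeomorphImage D'
      exact (F.disc_or_cylinder D' hD').imp (fun ⟨f⟩ => ⟨e.symm.trans f⟩)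
        (fun ⟨f⟩ => ⟨e.symm.trans f⟩)
  · intro c d h
    have key : ∀ c, H1.map Γ (⟨i ∘ E.ι, (hi.comp E.isometry_ι).continuous⟩ : C(_, _)) c =
        H1.map Γ ⟨i, hi.continuous⟩ (E.h1Map Γ c) := fun c =>
      H1.map_comp_apply Γ ⟨i, hi.continuous⟩ ⟨E.ι, E.isometry_ι.continuous⟩ c
    exact (key c).trans ((congrArg _ h).trans (key d).symm)
  · intro c d h
    have heq : (⟨i ∘ E.ι, (hi.comp E.isometry_ι).continuous⟩ : C(_, _)) =
        (⟨j, hj.continuous⟩ : C(_, _)).comp ⟨F.ι, F.isometry_ι.continuous⟩ := by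
      ext p
      exact congrFun hcomm p
    have key : ∀ c, H1.map Γ (⟨i ∘ E.ι, (hi.comp E.isometry_ι).continuous⟩ : C(_, _)) c =
        H1.map Γ ⟨j, hj.continuous⟩ (F.h1Map Γ c) := fun c => by
      rw [heq]
      exact H1.map_comp_apply Γ ⟨j, hj.continuous⟩ ⟨F.ι, F.isometry_ι.continuous⟩ c
    exact (key c).trans ((congrArg _ h).trans (key d).symm)
  · change ∑' D : components Sᶜ, area D.1 ≤ _
    refine (ENNReal.tsum_mono_subtype area hcomp).trans
      ((ENNReal.tsum_union_le area _ _).trans ?_)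
    rw [tsum_image area hi.injective.image_injective.injOn,
      tsum_image area hj.injective.image_injective.injOn]
    simp only [area_image hi, area_image hj]
    exact le_rfl

/-! ### The distance `d₁`, and the groups `H_d` and `Ĥ_d` -/

/-- The distance `d₁` on `H₁(X; Γ)`: the infimum of the excess areas of the area extensions of
`X` in which the two classes become homologous. -/
def d1 {X : Type u} [MetricSpace X] {Γ : Type u} [AddCommGroup Γ] (b c : H1 X Γ) : ℝ≥0∞ :=
  ⨅ (E : AreaExtension X) (_ : E.h1Map Γ b = E.h1Map Γ c), E.excessArea

section d1

variable {X : Type u} [MetricSpace X] {Γ : Type u} [AddCommGroup Γ]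

lemma d1_self (b : H1 X Γ) : d1 b b = 0 :=
  le_antisymm ((iInf_le_of_le (AreaExtension.trivial X) (iInf_le _ rfl)).trans
    AreaExtension.excessArea_trivial.le) zero_le

lemma d1_comm (b c : H1 X Γ) : d1 b c = d1 c b := by
  unfold d1
  simp only [eq_comm]

lemma d1_triangle [CompleteSpace X] (a b c : H1 X Γ) : d1 a c ≤ d1 a b + d1 b c := by
  rcases isEmpty_or_nonempty X with hX | hX
  · have := H1.subsingleton_of_isEmpty X Γ
    rw [Subsingleton.elim a c, d1_self]
    exact zero_le
  · refine ENNReal.le_of_forall_pos_le_add fun ε hε hlt => ?_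
    have hε' : (0 : ℝ≥0∞) < ε / 2 := ENNReal.half_pos (by exact_mod_cast hε.ne')
    have hab : d1 a b < ∞ := lt_of_le_of_lt le_self_add hlt
    have hbc : d1 b c < ∞ := lt_of_le_of_lt le_add_self hlt
    have h1 : d1 a b < d1 a b + ε / 2 := ENNReal.lt_add_right hab.ne hε'.ne'
    have h2 : d1 b c < d1 b c + ε / 2 := ENNReal.lt_add_right hbc.ne hε'.ne'
    obtain ⟨E, h1⟩ := iInf_lt_iff.1 h1
    obtain ⟨hE, h1⟩ := iInf_lt_iff.1 h1
    obtain ⟨F, h2⟩ := iInf_lt_iff.1 h2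
    obtain ⟨hF, h2⟩ := iInf_lt_iff.1 h2
    obtain ⟨G, hG1, hG2, hG⟩ := AreaExtension.exists_glue Γ E F
    calc d1 a c ≤ G.excessArea := iInf₂_le G ((hG1 _ _ hE).trans (hG2 _ _ hF))
      _ ≤ (d1 a b + ε / 2) + (d1 b c + ε / 2) := hG.trans (add_le_add h1.le h2.le)
      _ = d1 a b + d1 b c + ε := by
        rw [add_add_add_comm, ENNReal.add_halves]

lemma d1_add_right (a b c : H1 X Γ) : d1 (a + c) (b + c) ≤ d1 a b := by
  refine le_iInf₂ fun E hE => iInf₂_le E ?_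
  rw [map_add, map_add, hE]

lemma d1_neg (a b : H1 X Γ) : d1 (-a) (-b) ≤ d1 a b := by
  refine le_iInf₂ fun E hE => iInf₂_le E ?_
  rw [map_neg, map_neg, hE]

variable [CompleteSpace X]

/-- `H₁(X; Γ)` with the pseudo-metric `d₁` (which may take the value `∞`). Completeness of `X`
is used for the triangle inequality only. -/
instance : PseudoEMetricSpace (H1 X Γ) where
  edist := d1
  edist_self := d1_self
  edist_comm := d1_comm
  edist_triangle := d1_triangle

lemma edist_eq_d1 (a b : H1 X Γ) : edist a b = d1 a b := rfl

instance : IsUniformAddGroup (H1 X Γ) where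
  uniformContinuous_sub := by
    refine EMetric.uniformContinuous_iff.2 fun ε hε => ⟨ε / 2, ENNReal.half_pos hε.ne', ?_⟩
    rintro ⟨a, b⟩ ⟨a', b'⟩ h
    rw [Prod.edist_eq, max_lt_iff] at h
    calc edist (a - b) (a' - b') ≤ edist (a - b) (a' - b) + edist (a' - b) (a' - b') :=
          edist_triangle _ _ _
      _ ≤ edist a a' + edist b b' := by
          refine add_le_add ?_ ?_
          · rw [sub_eq_add_neg, sub_eq_add_neg]
            exact d1_add_right _ _ _
          · rw [sub_eq_neg_add, sub_eq_neg_add]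
            exact (d1_add_right _ _ _).trans (d1_neg _ _)
      _ < ε / 2 + ε / 2 := ENNReal.add_lt_add h.1 h.2
      _ = ε := ENNReal.add_halves ε

end d1

/-- The group `H_d(X; Γ)`: the quotient of `H₁(X; Γ)` in which classes at `d₁`-distance zero are
identified. -/
abbrev Hd (X : Type u) [MetricSpace X] [CompleteSpace X] (Γ : Type u) [AddCommGroup Γ] : Type u :=
  SeparationQuotient (H1 X Γ)

/-- The group `Ĥ_d(X; Γ)`: the completion of `H_d(X; Γ)` with respect to the metric `d₁`. -/
abbrev HdHat (X : Type u) [MetricSpace X] [CompleteSpace X] (Γ : Type u) [AddCommGroup Γ] :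
    Type u :=
  UniformSpace.Completion (Hd X Γ)

/-- The canonical map `H₁(X; Γ) → H_d(X; Γ) → Ĥ_d(X; Γ)`. -/
def toHdHat {X : Type u} [MetricSpace X] [CompleteSpace X] {Γ : Type u} [AddCommGroup Γ]
    (c : H1 X Γ) : HdHat X Γ :=
  ((SeparationQuotient.mk c : Hd X Γ) : UniformSpace.Completion (Hd X Γ))

/-! ### Locally finite 1-complexes -/

/-- The path metric on a 1-complex `X` in which every edge has length `1` (and is traversed at
constant speed by its characteristic map, which is defined on `[-1, 1]`). It is the largest
extended pseudo-metric on `X` for which `dist (e s) (e t) ≤ |s - t| / 2` holds for the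
characteristic map of each edge `e`; points in distinct components have distance `∞`. -/
def edgeDist {X : Type u} [TopologicalSpace X] [CWComplex (univ : Set X)] (x y : X) : ℝ≥0∞ :=
  ⨆ (m : PseudoEMetricSpace X) (_ : ∀ (e : RelCWComplex.cell (univ : Set X) 1),
    ∀ s ∈ Metric.closedBall (0 : Fin 1 → ℝ) 1, ∀ t ∈ Metric.closedBall (0 : Fin 1 → ℝ) 1,
      m.edist (RelCWComplex.map 1 e s) (RelCWComplex.map 1 e t) ≤ edist s t / 2), m.edist x y

/-- `X` is a locally finite 1-complex: a CW complex without cells of dimension greater than `1`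
whose closed cells form a locally finite family. Its metric, which induces the topology of the
complex, is required to be uniformly at least as fine as the path metric with edges of
length `1`. This holds for that path metric itself, for every path metric with edge lengths
bounded away from `0`, and for every metric inducing the topology if the complex is finite. -/
class LocallyFiniteMetricOneComplex (X : Type u) [MetricSpace X] [CWComplex (univ : Set X)] :
    Prop where
  isEmpty_cell : ∀ n, 2 ≤ n → IsEmpty (RelCWComplex.cell (univ : Set X) n)
  locallyFinite : LocallyFinite fun c : Σ n, RelCWComplex.cell (univ : Set X) n =>
    RelCWComplex.closedCell c.1 c.2
  uniform : ∀ ε : ℝ≥0∞, 0 < ε → ∃ δ : ℝ≥0∞, 0 < δ ∧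
    ∀ x y : X, edist x y < δ → edgeDist x y < ε

section complete

variable {X : Type u} [MetricSpace X] [CWComplex (univ : Set X)]

lemma notMem_openCell_one_of_mem_openCell_zero {x : X} {v : RelCWComplex.cell (univ : Set X) 0}
    (hx : x ∈ RelCWComplex.openCell 0 v) (e : RelCWComplex.cell (univ : Set X) 1) :
    x ∉ RelCWComplex.openCell 1 e := fun h =>
  disjoint_left.1 (RelCWComplex.disjoint_openCell_of_ne (by simp)) hx h

open Classical in
/-- The function which vanishes on the finite set `W`, is `1` at all other vertices and is affine
on each edge (auxiliary for the proof of completeness). -/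
def vertexFun (W : Set X) (y : X) : ℝ :=
  if h : ∃ e : RelCWComplex.cell (univ : Set X) 1, y ∈ RelCWComplex.openCell 1 e then
    (1 - (RelCWComplex.map 1 h.choose).symm y 0) / 2 *
        Wᶜ.indicator 1 (RelCWComplex.map 1 h.choose fun _ => -1) +
      (1 + (RelCWComplex.map 1 h.choose).symm y 0) / 2 *
        Wᶜ.indicator 1 (RelCWComplex.map 1 h.choose fun _ => 1)
  else Wᶜ.indicator 1 y

lemma vertexFun_map (W : Set X) (e : RelCWComplex.cell (univ : Set X) 1) (t : Fin 1 → ℝ)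
    (ht : t ∈ Metric.closedBall (0 : Fin 1 → ℝ) 1) :
    vertexFun W (RelCWComplex.map 1 e t) =
      (1 - t 0) / 2 * Wᶜ.indicator 1 (RelCWComplex.map 1 e fun _ => -1) +
      (1 + t 0) / 2 * Wᶜ.indicator 1 (RelCWComplex.map 1 e fun _ => 1) := by
  by_cases hb : t ∈ Metric.ball (0 : Fin 1 → ℝ) 1
  · have hmem : RelCWComplex.map 1 e t ∈ RelCWComplex.openCell 1 e := mem_image_of_mem _ hb
    have hex : ∃ e' : RelCWComplex.cell (univ : Set X) 1,
      RelCWComplex.map 1 e t ∈ RelCWComplex.openCell 1 e' := ⟨e, hmem⟩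
    have hch : hex.choose = e := by
      have := RelCWComplex.eq_of_not_disjoint_openCell
        (not_disjoint_iff.2 ⟨_, hex.choose_spec, hmem⟩)
      simpa using this
    have hsymm : (RelCWComplex.map 1 e).symm (RelCWComplex.map 1 e t) = t :=
      (RelCWComplex.map 1 e).left_inv (by rw [RelCWComplex.source_eq]; exact hb)
    rw [vertexFun, dif_pos hex, hch, hsymm]
  · have hs : t ∈ Metric.sphere (0 : Fin 1 → ℝ) 1 := by
      rw [← Metric.closedBall_sdiff_ball]
      exact ⟨ht, hb⟩
    have hfr : RelCWComplex.map 1 e t ∈ RelCWComplex.cellFrontier 1 e := mem_image_of_mem _ hs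
    obtain ⟨v, w, hvw⟩ := CWComplex.exists_cellFrontier_one_eq e
    have hno : ¬ ∃ e' : RelCWComplex.cell (univ : Set X) 1,
        RelCWComplex.map 1 e t ∈ RelCWComplex.openCell 1 e' := by
      rintro ⟨e', he'⟩
      rw [hvw, RelCWComplex.closedCell_zero_eq_singleton,
        RelCWComplex.closedCell_zero_eq_singleton, ← RelCWComplex.openCell_zero_eq_singleton,
        ← RelCWComplex.openCell_zero_eq_singleton] at hfr
      rcases hfr with h | h
      · exact notMem_openCell_one_of_mem_openCell_zero h e' he'
      · exact notMem_openCell_one_of_mem_openCell_zero h e' he'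
    rw [vertexFun, dif_neg hno]
    have ht0 : |t 0| = 1 := by
      rw [mem_sphere_iff_norm, sub_zero] at hs
      rw [← hs, Pi.norm_def]
      simp
    rcases (abs_eq zero_le_one).1 ht0 with h | h
    · have : t = fun _ => 1 := by
        ext i; rw [Subsingleton.elim i 0, h]
      rw [this]; norm_num
    · have : t = fun _ => -1 := by
        ext i; rw [Subsingleton.elim i 0, h]
      rw [this]; norm_num

lemma edist_vertexFun_le (W : Set X) (x y : X) :
    edist (vertexFun W x) (vertexFun W y) ≤ edgeDist x y := by
  refine le_iSup₂_of_le (PseudoEMetricSpace.induced (vertexFun W) inferInstance) ?_ le_rfl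
  intro e s hs t ht
  change edist (vertexFun W (RelCWComplex.map 1 e s)) (vertexFun W (RelCWComplex.map 1 e t)) ≤ _
  rw [vertexFun_map W e s hs, vertexFun_map W e t ht]
  refine le_trans ?_ (ENNReal.div_le_div_right (edist_le_pi_edist s t 0) 2)
  rw [edist_dist, edist_dist]
  have h2 : ENNReal.ofReal (dist (s 0) (t 0)) / 2 = ENNReal.ofReal (dist (s 0) (t 0) / 2) := by
    rw [ENNReal.ofReal_div_of_pos two_pos]; simp
  rw [h2]
  refine ENNReal.ofReal_le_ofReal ?_
  have hind : ∀ z : X, 0 ≤ Wᶜ.indicator (1 : X → ℝ) z ∧ Wᶜ.indicator (1 : X → ℝ) z ≤ 1 := by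
    intro z
    by_cases hz : z ∈ Wᶜ
    · simp [indicator_of_mem hz]
    · simp [indicator_of_notMem hz]
  obtain ⟨ha0, ha1⟩ := hind (RelCWComplex.map 1 e fun _ => -1)
  obtain ⟨hb0, hb1⟩ := hind (RelCWComplex.map 1 e fun _ => 1)
  set a := Wᶜ.indicator (1 : X → ℝ) (RelCWComplex.map 1 e fun _ => -1)
  set b := Wᶜ.indicator (1 : X → ℝ) (RelCWComplex.map 1 e fun _ => 1)
  rw [Real.dist_eq, Real.dist_eq]
  have : (1 - s 0) / 2 * a + (1 + s 0) / 2 * b - ((1 - t 0) / 2 * a + (1 + t 0) / 2 * b) =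
      (s 0 - t 0) / 2 * (b - a) := by ring
  rw [this, abs_mul, abs_div, abs_two]
  have hba : |b - a| ≤ 1 := abs_le.2 ⟨by linarith, by linarith⟩
  exact mul_le_of_le_one_right (by positivity) hba

variable [LocallyFiniteMetricOneComplex X]

lemma exists_finite_vertexFun_eq_zero (x : X) : ∃ W : Set X, W.Finite ∧ vertexFun W x = 0 := by
  have hx : x ∈ ⋃ (n : ℕ) (j : RelCWComplex.cell (univ : Set X) n), RelCWComplex.openCell n j := by
    rw [CWComplex.iUnion_openCell_eq_complex]
    exact mem_univ x
  simp only [mem_iUnion] at hx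
  obtain ⟨n, j, hj⟩ := hx
  match n, j, hj with
  | 0, j, hj =>
    refine ⟨{x}, finite_singleton x, ?_⟩
    have hno : ¬ ∃ e' : RelCWComplex.cell (univ : Set X) 1, x ∈ RelCWComplex.openCell 1 e' := by
      rintro ⟨e', he'⟩
      exact notMem_openCell_one_of_mem_openCell_zero hj e' he'
    rw [vertexFun, dif_neg hno]
    simp
  | 1, e, hj =>
    refine ⟨{RelCWComplex.map 1 e fun _ => -1, RelCWComplex.map 1 e fun _ => 1}, by simp, ?_⟩
    obtain ⟨t, ht, rfl⟩ := RelCWComplex.openCell_subset_closedCell _ _ hj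
    rw [vertexFun_map _ e t ht]
    simp
  | n + 2, j, hj =>
    exact ((LocallyFiniteMetricOneComplex.isEmpty_cell (X := X) (n + 2) (by lia)).false j).elim

lemma exists_isCompact_of_edgeDist_lt (x : X) :
    ∃ K : Set X, IsCompact K ∧ ∀ y, edgeDist x y < 1 → y ∈ K := by
  obtain ⟨W, hW, hx⟩ := exists_finite_vertexFun_eq_zero x
  set A : Set (RelCWComplex.cell (univ : Set X) 1) :=
    {e | (RelCWComplex.closedCell 1 e ∩ W).Nonempty} with hA
  have hAfin : A.Finite := by
    have : A ⊆ ⋃ w ∈ W, Sigma.mk 1 ⁻¹'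
        {c : Σ n, RelCWComplex.cell (univ : Set X) n | w ∈ RelCWComplex.closedCell c.1 c.2} := by
      rintro e ⟨w, hw1, hw2⟩
      simp only [mem_iUnion]
      exact ⟨w, hw2, hw1⟩
    refine Set.Finite.subset (hW.biUnion fun w _ => ?_) this
    exact (LocallyFiniteMetricOneComplex.locallyFinite.point_finite w).preimage
      sigma_mk_injective.injOn
  refine ⟨W ∪ ⋃ e ∈ A, RelCWComplex.closedCell 1 e, hW.isCompact.union
    (hAfin.isCompact_biUnion fun e _ => RelCWComplex.isCompact_closedCell), fun y hy => ?_⟩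
  have h1 : edist (vertexFun W x) (vertexFun W y) < 1 := (edist_vertexFun_le W x y).trans_lt hy
  have h2 : vertexFun W y < 1 := by
    rw [hx, edist_dist, ← ENNReal.ofReal_one, ENNReal.ofReal_lt_ofReal_iff one_pos, Real.dist_eq,
      zero_sub, abs_neg] at h1
    exact (le_abs_self _).trans_lt h1
  by_contra hy'
  rw [mem_union, not_or] at hy'
  obtain ⟨hyW, hyA⟩ := hy'
  by_cases hex : ∃ e : RelCWComplex.cell (univ : Set X) 1, y ∈ RelCWComplex.openCell 1 e
  · obtain ⟨e, he⟩ := hex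
    have hec := RelCWComplex.openCell_subset_closedCell _ _ he
    have heA : e ∉ A := fun h => hyA (mem_biUnion h hec)
    have hend : ∀ t ∈ Metric.closedBall (0 : Fin 1 → ℝ) 1, RelCWComplex.map 1 e t ∈ Wᶜ :=
      fun t ht h => heA ⟨_, mem_image_of_mem _ ht, h⟩
    obtain ⟨t, ht, rfl⟩ := hec
    rw [vertexFun_map _ e t ht, indicator_of_mem (hend _ ?_), indicator_of_mem (hend _ ?_)] at h2
    · simp only [Pi.one_apply] at h2
      linarith
    · simp [Pi.norm_def]
    · simp [Pi.norm_def]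
  · rw [vertexFun, dif_neg hex, indicator_of_mem (show y ∈ Wᶜ from hyW)] at h2
    simp at h2

/-- The metric of a locally finite 1-complex is complete. -/
instance : CompleteSpace X := by
  obtain ⟨δ, hδ, hu⟩ := LocallyFiniteMetricOneComplex.uniform (X := X) 1 one_pos
  refine EMetric.complete_of_cauchySeq_tendsto fun u hcu => ?_
  obtain ⟨N, hN⟩ := EMetric.cauchySeq_iff.1 hcu δ hδ
  obtain ⟨K, hK, hKy⟩ := exists_isCompact_of_edgeDist_lt (u N)
  have hmem : ∀ n, N ≤ n → u n ∈ K := fun n hn => hKy _ (hu _ _ (hN N le_rfl n hn))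
  obtain ⟨a, -, ha⟩ := cauchySeq_tendsto_of_isComplete (u := fun n => u (n + N)) hK.isComplete
    (fun n => hmem _ (Nat.le_add_left N n))
    (hcu.comp_tendsto (Filter.tendsto_add_atTop_nat N))
  exact ⟨a, (Filter.tendsto_add_atTop_iff_nat N).1 ha⟩

end complete

end LengthHomology

end

/-!
The classes in `H₁(X; Γ)` of a locally finite 1-complex `X` are uniformly discrete for `d₁`
(`exists_forall_d1_lt_imp_eq`). So no two classes are identified in `H_d`, and the completion adds
nothing (`toHdHat_bijective`).

For an edge `e` let `g : X → S¹` be the map which wraps `e` once around the circle and is constant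
outside `e` (`edgeCircle`). A class in `H₁(X; Γ)` whose winding numbers along all these maps vanish
is zero (`eq_zero_of_windingHom_edgeCircle`): up to a boundary each cycle is a combination of the
edges, and the winding numbers are the coefficients. For the first of these two facts,
`cocycle_eq_zero` shows that a cocycle which vanishes on the edges is a coboundary. This is checked
locally along each path, where a path near a vertex is deformed into the vertex by stretching the
edges.

Now let `X'` be an area extension of small excess area. It remains to extend `g`, up to homotopy, to
`X'`, because then the winding numbers of a class are determined by its image in `H₁(X'; Γ)`. This
is `exists_extension_to_circle`. Near `X` the map extends by averaging, since it is uniformly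
continuous. By a coarea inequality (`exists_level`), the distance from `X` has a level set `L` of
small length near `X`. Such a set decomposes into small clopen pieces, since by the one-dimensional
analogue of the same inequality it is missed by some small spheres around its points
(`exists_radius`). So the map has a continuous argument on `L`, which extends beyond `L` by the
Tietze theorem. The bounds depend only on the modulus of continuity of `g`, which is the same for
all edges (`exists_dist_lt_imp_edgeCircle`).

This uses that the area of the complement of `X` in `X'` is at most the excess area, although
the components need not be open and could a priori be uncountably many. But a component has positive
area: if a topological disc had area zero, then the same extension theorem would show that the
identity of its boundary circle extends to the disc, up to homotopy (`area_range_disc_ne_zero`).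
-/

noncomputable section

namespace LengthHomology

/-! ### Singular chains -/

/-- The standard topological `n`-simplex. -/
abbrev Simplex (n : ℕ) : Type := stdSimplex ℝ (Fin (n + 1))

/-- The inclusion of the `i`-th face of the standard simplex. -/
def Simplex.face {n : ℕ} (i : Fin (n + 2)) : C(Simplex n, Simplex (n + 1)) :=
  ⟨stdSimplex.map i.succAbove, stdSimplex.continuous_map _⟩

section Chain

variable (X : Type u) [TopologicalSpace X] (Γ : Type u) [AddCommGroup Γ]

/-- The singular chain complex of `X` with coefficients in `Γ`. -/
abbrev chainComplex : ChainComplex AddCommGrpCat.{u} ℕ :=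
  (TopCat.toSSet.obj (TopCat.of X)).chainComplex (AddCommGrpCat.of Γ)

/-- The group of singular `n`-chains of `X` with coefficients in `Γ`. -/
abbrev Chain (n : ℕ) : Type u := (chainComplex X Γ).X n

variable {X}

/-- The singular simplex `σ`, as an element of Mathlib's singular simplicial set. -/
def toSing {n : ℕ} (σ : C(Simplex n, X)) :
    (TopCat.toSSet.obj (TopCat.of X)).obj (.op (SimplexCategory.mk n)) :=
  ((TopCat.of X).toSSetObjEquiv (.op (SimplexCategory.mk n))).symm σ

lemma toSing_surjective {n : ℕ} : Function.Surjective (toSing (X := X) (n := n)) :=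
  Equiv.surjective _

variable {Γ}

/-- The chain `γ · σ`. -/
def single {n : ℕ} (σ : C(Simplex n, X)) : Γ →+ Chain X Γ n :=
  (SSet.ιChainComplex (R := AddCommGrpCat.of Γ) _ (toSing σ)).hom

/-- Homomorphisms on chains are determined by their values on the chains `γ · σ`. -/
lemma Chain.hom_ext {n : ℕ} {M : Type u} [AddCommGroup M] {f g : Chain X Γ n →+ M}
    (h : ∀ σ γ, f (single σ γ) = g (single σ γ)) : f = g := by
  have : AddCommGrpCat.ofHom f = AddCommGrpCat.ofHom g := by
    refine SSet.chainComplex_hom_ext fun x => ?_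
    obtain ⟨σ, rfl⟩ := toSing_surjective x
    ext γ
    exact h σ γ
  exact congrArg AddCommGrpCat.Hom.hom this

/-- The homomorphism on chains with given values on the chains `γ · σ`. -/
def Chain.lift {n : ℕ} {M : Type u} [AddCommGroup M] (φ : C(Simplex n, X) → Γ →+ M) :
    Chain X Γ n →+ M :=
  (Limits.Sigma.desc (f := fun _ => AddCommGrpCat.of Γ) fun x =>
    AddCommGrpCat.ofHom (φ ((TopCat.of X).toSSetObjEquiv (.op (SimplexCategory.mk n)) x))).hom

@[simp]
lemma Chain.lift_single {n : ℕ} {M : Type u} [AddCommGroup M] (φ : C(Simplex n, X) → Γ →+ M)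
    (σ : C(Simplex n, X)) (γ : Γ) : Chain.lift φ (single σ γ) = φ σ γ := by
  have := Limits.Sigma.ι_desc (f := fun _ => AddCommGrpCat.of Γ) (fun x =>
    AddCommGrpCat.ofHom (φ ((TopCat.of X).toSSetObjEquiv (.op (SimplexCategory.mk n)) x)))
    (toSing σ)
  exact congrArg (fun k => AddCommGrpCat.Hom.hom k γ) this

variable (X Γ)

/-- The boundary homomorphism on chains. -/
def bdry (n : ℕ) : Chain X Γ (n + 1) →+ Chain X Γ n := ((chainComplex X Γ).d (n + 1) n).hom

variable {X Γ}

lemma bdry_single {n : ℕ} (σ : C(Simplex (n + 1), X)) (γ : Γ) :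
    bdry X Γ n (single σ γ) =
      ∑ i : Fin (n + 2), (-1 : ℤ) ^ i.val • single (σ.comp (Simplex.face i)) γ := by
  have := SSet.ιChainComplex_d (TopCat.toSSet.obj (TopCat.of X)) (AddCommGrpCat.of Γ) (toSing σ)
  -- evaluation at `γ`, as a homomorphism, so that it can be moved inside the sum
  let ev : (AddCommGrpCat.of Γ ⟶ (chainComplex X Γ).X n) →+ Chain X Γ n :=
    { toFun := fun k => k.hom γ
      map_zero' := rfl
      map_add' := fun _ _ => rfl }
  refine (congrArg ev this).trans ?_
  rw [map_sum]
  refine Finset.sum_congr rfl fun i _ => ?_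
  rw [map_zsmul]
  rfl

lemma bdry_single_one (σ : C(Simplex 1, X)) (γ : Γ) :
    bdry X Γ 0 (single σ γ) =
      single (σ.comp (Simplex.face 0)) γ - single (σ.comp (Simplex.face 1)) γ := by
  rw [bdry_single, Fin.sum_univ_two]
  simp [sub_eq_add_neg]

lemma bdry_single_two (σ : C(Simplex 2, X)) (γ : Γ) :
    bdry X Γ 1 (single σ γ) = single (σ.comp (Simplex.face 0)) γ -
      single (σ.comp (Simplex.face 1)) γ + single (σ.comp (Simplex.face 2)) γ := by
  rw [bdry_single, Fin.sum_univ_three]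
  simp [sub_eq_add_neg]

/-- The homomorphism on chains induced by a continuous map. -/
def Chain.map {Y : Type u} [TopologicalSpace Y] (f : C(X, Y)) (n : ℕ) :
    Chain X Γ n →+ Chain Y Γ n :=
  ((SSet.chainComplexMap (TopCat.toSSet.map (TopCat.ofHom f)) (AddCommGrpCat.of Γ)).f n).hom

@[simp]
lemma Chain.map_single {Y : Type u} [TopologicalSpace Y] (f : C(X, Y)) {n : ℕ}
    (σ : C(Simplex n, X)) (γ : Γ) : Chain.map f n (single σ γ) = single (f.comp σ) γ := by
  have := SSet.ι_chainComplexMap_f _ _ (TopCat.toSSet.map (TopCat.ofHom f))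
    (AddCommGrpCat.of Γ) (toSing σ)
  exact congrArg (fun k => AddCommGrpCat.Hom.hom k γ) this

/-! ### Classes in the first homology group -/

/-- The kernel of the boundary homomorphism, mapped to the categorical object of cycles. -/
def toCycles : (bdry X Γ 0).ker →+ (chainComplex X Γ).cycles 1 :=
  ((chainComplex X Γ).liftCycles (A := AddCommGrpCat.of (bdry X Γ 0).ker)
    (AddCommGrpCat.ofHom (bdry X Γ 0).ker.subtype) 0 (by simp) (by ext z; exact z.2)).hom

/-- The class of a cycle in `H₁`. -/
def H1.mk : (bdry X Γ 0).ker →+ H1 X Γ :=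
  ((chainComplex X Γ).homologyπ 1).hom.comp toCycles

lemma iCycles_toCycles (z : (bdry X Γ 0).ker) :
    ((chainComplex X Γ).iCycles 1).hom (toCycles z) = z :=
  congrArg (fun k => AddCommGrpCat.Hom.hom k z) ((chainComplex X Γ).liftCycles_i
    (A := AddCommGrpCat.of (bdry X Γ 0).ker)
    (AddCommGrpCat.ofHom (bdry X Γ 0).ker.subtype) 0 (by simp) (by ext z; exact z.2))

lemma iCycles_injective : Function.Injective ((chainComplex X Γ).iCycles 1).hom :=
  (AddCommGrpCat.mono_iff_injective _).1 inferInstance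

lemma H1.mk_surjective : Function.Surjective (H1.mk (X := X) (Γ := Γ)) := by
  intro c
  obtain ⟨y, hy⟩ := (AddCommGrpCat.epi_iff_surjective ((chainComplex X Γ).homologyπ 1)).1
    inferInstance c
  have hz : bdry X Γ 0 (((chainComplex X Γ).iCycles 1).hom y) = 0 :=
    congrArg (fun k => AddCommGrpCat.Hom.hom k y) ((chainComplex X Γ).iCycles_d 1 0)
  refine ⟨⟨((chainComplex X Γ).iCycles 1).hom y, hz⟩, ?_⟩
  rw [← hy]
  exact congrArg ((chainComplex X Γ).homologyπ 1).hom (iCycles_injective (iCycles_toCycles _))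

lemma H1.mk_eq_zero (z : (bdry X Γ 0).ker) (w : Chain X Γ 2) (h : z = bdry X Γ 1 w) :
    H1.mk z = 0 := by
  have h1 : toCycles z = ((chainComplex X Γ).toCycles 2 1).hom w := by
    refine iCycles_injective ((iCycles_toCycles _).trans (h.trans ?_))
    exact (congrArg (fun k => AddCommGrpCat.Hom.hom k w)
      ((chainComplex X Γ).toCycles_i 2 1)).symm
  refine (congrArg ((chainComplex X Γ).homologyπ 1).hom h1).trans ?_
  exact congrArg (fun k => AddCommGrpCat.Hom.hom k w)
    ((chainComplex X Γ).toCycles_comp_homologyπ 2 1)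

/-- The homomorphism on `H₁` given by a cocycle. -/
def H1.pair {M : Type u} [AddCommGroup M] (ψ : Chain X Γ 1 →+ M)
    (h : ∀ w, ψ (bdry X Γ 1 w) = 0) : H1 X Γ →+ M :=
  ((chainComplex X Γ).homologyι 1 ≫ (chainComplex X Γ).descOpcycles
    (A := AddCommGrpCat.of M) (AddCommGrpCat.ofHom ψ) 2 (by simp) (by ext w; exact h w)).hom

lemma H1.pair_mk {M : Type u} [AddCommGroup M] (ψ : Chain X Γ 1 →+ M)
    (h : ∀ w, ψ (bdry X Γ 1 w) = 0) (z : (bdry X Γ 0).ker) :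
    H1.pair ψ h (H1.mk z) = ψ z := by
  have h1 := ((chainComplex X Γ).homology_π_ι_assoc 1 ((chainComplex X Γ).descOpcycles
    (A := AddCommGrpCat.of M) (AddCommGrpCat.ofHom ψ) 2 (by simp) (by ext w; exact h w))).trans
    (congrArg (fun k => (chainComplex X Γ).iCycles 1 ≫ k) ((chainComplex X Γ).p_descOpcycles
      (A := AddCommGrpCat.of M) (AddCommGrpCat.ofHom ψ) 2 (by simp) (by ext w; exact h w)))
  refine (congrArg (fun k => AddCommGrpCat.Hom.hom k (toCycles z)) h1).trans ?_
  exact congrArg ψ (iCycles_toCycles z)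

lemma bdry_map {Y : Type u} [TopologicalSpace Y] (f : C(X, Y)) (n : ℕ) (z : Chain X Γ (n + 1)) :
    bdry Y Γ n (Chain.map f (n + 1) z) = Chain.map f n (bdry X Γ n z) :=
  (congrArg (fun k => AddCommGrpCat.Hom.hom k z)
    ((SSet.chainComplexMap (TopCat.toSSet.map (TopCat.ofHom f)) (AddCommGrpCat.of Γ)).comm
      (n + 1) n))

lemma H1.map_mk {Y : Type u} [TopologicalSpace Y] (f : C(X, Y)) (z : (bdry X Γ 0).ker) :
    H1.map Γ f (H1.mk z) = H1.mk ⟨Chain.map f 1 z, by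
      rw [AddMonoidHom.mem_ker, bdry_map, z.2, map_zero]⟩ := by
  set F := SSet.chainComplexMap (TopCat.toSSet.map (TopCat.ofHom f)) (AddCommGrpCat.of Γ)
  have h1 : (HomologicalComplex.cyclesMap F 1).hom (toCycles z) =
      toCycles ⟨Chain.map f 1 z, by rw [AddMonoidHom.mem_ker, bdry_map, z.2, map_zero]⟩ := by
    refine iCycles_injective (Eq.trans ?_ (iCycles_toCycles _).symm)
    refine (congrArg (fun k => AddCommGrpCat.Hom.hom k _)
      (HomologicalComplex.cyclesMap_i F 1)).trans ?_
    exact congrArg (Chain.map f 1) (iCycles_toCycles z)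
  refine (congrArg (fun k => AddCommGrpCat.Hom.hom k (toCycles z))
    (HomologicalComplex.homologyπ_naturality F 1)).trans ?_
  exact congrArg ((chainComplex Y Γ).homologyπ 1).hom h1

end Chain

/-! ### Winding numbers -/

/-- A map from a contractible space to the circle lifts to `ℝ`, by lifting a contraction. -/
lemma exists_circle_lift {A : Type*} [TopologicalSpace A] [ContractibleSpace A]
    (f : C(A, Circle)) : ∃ θ : C(A, ℝ), ∀ a, Circle.exp (θ a) = f a := by
  obtain ⟨a₀, ⟨H⟩⟩ := id_nullhomotopic A
  have ht : Circle.exp (f a₀ : ℂ).arg = f a₀ := Circle.exp_arg _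
  set t := (f a₀ : ℂ).arg
  have h0 : ∀ a, (f.comp H.symm.toContinuousMap) (0, a) =
      Circle.exp (ContinuousMap.const A t a) := by
    intro a
    simp [ht]
  refine ⟨(Circle.isCoveringMap_exp.liftHomotopy (f.comp H.symm.toContinuousMap)
    (ContinuousMap.const A t) h0).comp ⟨fun a => (1, a), by fun_prop⟩, fun a => ?_⟩
  have := congrFun (Circle.isCoveringMap_exp.liftHomotopy_lifts (f.comp H.symm.toContinuousMap)
    (ContinuousMap.const A t) h0) (1, a)
  refine this.trans ?_
  simp

instance (n : ℕ) : ContractibleSpace (Simplex n) :=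
  (convex_stdSimplex ℝ (Fin (n + 1))).contractibleSpace ⟨_, single_mem_stdSimplex ℝ 0⟩

lemma circle_exp_eq_one_iff (t : ℝ) : Circle.exp t = 1 ↔ ∃ n : ℤ, t = 2 * Real.pi * n := by
  rw [Circle.exp_eq_one]
  simp only [mul_comm]

/-- The increments of lifts of a map to the circle do not depend on the lift. -/
lemma circle_lift_sub_eq {A : Type*} [TopologicalSpace A] [PreconnectedSpace A] {θ θ' : C(A, ℝ)}
    (h : ∀ a, Circle.exp (θ a) = Circle.exp (θ' a)) (a b : A) : θ a - θ b = θ' a - θ' b := by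
  have := Circle.isCoveringMap_exp.eq_of_comp_eq (g₁ := θ) (g₂ := fun x => θ' x + (θ b - θ' b))
    θ.continuous (by fun_prop) (by
      ext x
      simp only [Function.comp_apply, Circle.exp_add, Circle.exp_sub, h]
      simp) b (by ring)
  have := congrFun this a
  linarith

lemma exists_circle_exp_int {z w : Circle} {s t : ℝ} (hs : Circle.exp s = z)
    (ht : Circle.exp t = w) :
    ∃ n : ℤ, t - s = 2 * Real.pi * n + (w : ℂ).arg - (z : ℂ).arg := by
  have : Circle.exp (t - s - ((w : ℂ).arg - (z : ℂ).arg)) = 1 := by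
    rw [Circle.exp_sub, Circle.exp_sub, Circle.exp_sub, hs, ht, Circle.exp_arg, Circle.exp_arg,
      div_self']
  obtain ⟨n, hn⟩ := (circle_exp_eq_one_iff _).1 this
  exact ⟨n, by linarith⟩

/-- The `i`-th vertex of the standard simplex. -/
abbrev Simplex.vertex {n : ℕ} (i : Fin (n + 1)) : Simplex n := stdSimplex.vertex i

lemma Simplex.face_vertex {n : ℕ} (i : Fin (n + 2)) (j : Fin (n + 1)) :
    Simplex.face i (Simplex.vertex j) = Simplex.vertex (i.succAbove j) :=
  stdSimplex.map_vertex _ _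

lemma exists_winding (p : C(Simplex 1, Circle)) :
    ∃ n : ℤ, ∀ θ : C(Simplex 1, ℝ), (∀ a, Circle.exp (θ a) = p a) →
      θ (Simplex.vertex 1) - θ (Simplex.vertex 0) = 2 * Real.pi * n +
        (p (Simplex.vertex 1) : ℂ).arg - (p (Simplex.vertex 0) : ℂ).arg := by
  obtain ⟨θ, hθ⟩ := exists_circle_lift p
  obtain ⟨n, hn⟩ := exists_circle_exp_int (hθ (Simplex.vertex 0)) (hθ (Simplex.vertex 1))
  refine ⟨n, fun θ' hθ' => ?_⟩
  rw [← hn]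
  exact circle_lift_sub_eq (fun a => (hθ' a).trans (hθ a).symm) _ _

/-- The number of turns of a path in the circle. It is the increment of a lift of the path
to `ℝ`, divided by `2π` and corrected by the principal arguments of the end points so that it
is an integer. -/
def winding (p : C(Simplex 1, Circle)) : ℤ := (exists_winding p).choose

lemma two_pi_mul_winding {p : C(Simplex 1, Circle)} {θ : C(Simplex 1, ℝ)}
    (h : ∀ a, Circle.exp (θ a) = p a) :
    2 * Real.pi * winding p = θ (Simplex.vertex 1) - θ (Simplex.vertex 0) -
        (p (Simplex.vertex 1) : ℂ).arg + (p (Simplex.vertex 0) : ℂ).arg := by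
  have := (exists_winding p).choose_spec θ h
  rw [winding]
  linarith

lemma two_pi_mul_int_inj {m n : ℤ} (h : 2 * Real.pi * m = 2 * Real.pi * n) : m = n := by
  exact_mod_cast mul_left_cancel₀ Real.two_pi_pos.ne' h

/-- The winding number is a cocycle. -/
lemma winding_face (σ : C(Simplex 2, Circle)) :
    winding (σ.comp (Simplex.face 0)) - winding (σ.comp (Simplex.face 1)) +
      winding (σ.comp (Simplex.face 2)) = 0 := by
  obtain ⟨θ, hθ⟩ := exists_circle_lift σ
  have h : ∀ i, _ := fun i => two_pi_mul_winding (p := σ.comp (Simplex.face i))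
    (θ := θ.comp (Simplex.face i)) (fun a => hθ _)
  refine two_pi_mul_int_inj ?_
  push_cast
  rw [mul_add, mul_sub, h, h, h]
  simp only [ContinuousMap.comp_apply, Simplex.face_vertex]
  have e1 : (0 : Fin 3).succAbove (0 : Fin 2) = 1 := rfl
  have e2 : (0 : Fin 3).succAbove (1 : Fin 2) = 2 := rfl
  have e3 : (1 : Fin 3).succAbove (0 : Fin 2) = 0 := rfl
  have e4 : (1 : Fin 3).succAbove (1 : Fin 2) = 2 := rfl
  have e5 : (2 : Fin 3).succAbove (0 : Fin 2) = 0 := rfl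
  have e6 : (2 : Fin 3).succAbove (1 : Fin 2) = 1 := rfl
  rw [e1, e2, e3, e4, e5, e6]
  ring

section

variable {X : Type u} [TopologicalSpace X] {Γ : Type u} [AddCommGroup Γ]

/-- The `Γ`-valued cocycle which sends `γ · p` to `γ` times the winding number of `f ∘ p`. -/
def windingChain (f : C(X, Circle)) : Chain X Γ 1 →+ Γ :=
  Chain.lift fun σ => winding (f.comp σ) • AddMonoidHom.id Γ

lemma windingChain_single (f : C(X, Circle)) (σ : C(Simplex 1, X)) (γ : Γ) :
    windingChain f (single σ γ) = winding (f.comp σ) • γ := by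
  simp [windingChain]

lemma windingChain_bdry (f : C(X, Circle)) (w : Chain X Γ 2) :
    windingChain f (bdry X Γ 1 w) = 0 := by
  suffices h : (windingChain f).comp (bdry X Γ 1) = 0 from DFunLike.congr_fun h w
  refine Chain.hom_ext fun σ γ => ?_
  rw [AddMonoidHom.comp_apply, bdry_single_two, map_add, map_sub, windingChain_single,
    windingChain_single, windingChain_single, ← sub_smul, ← add_smul]
  exact (congrArg (· • γ) (winding_face (f.comp σ))).trans (zero_smul _ _)

/-- The homomorphism `H₁(X; Γ) → Γ` given by the winding number along `f : X → S¹`. -/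
def windingHom (f : C(X, Circle)) : H1 X Γ →+ Γ :=
  H1.pair (windingChain f) (windingChain_bdry f)

lemma windingHom_map {Y : Type u} [TopologicalSpace Y] (f : C(Y, Circle)) (g : C(X, Y))
    (c : H1 X Γ) : windingHom f (H1.map Γ g c) = windingHom (f.comp g) c := by
  obtain ⟨z, rfl⟩ := H1.mk_surjective c
  rw [H1.map_mk, windingHom, windingHom, H1.pair_mk, H1.pair_mk]
  suffices h : (windingChain f).comp (Chain.map g 1) = windingChain (Γ := Γ) (f.comp g) from
    DFunLike.congr_fun h z.1
  refine Chain.hom_ext fun σ γ => ?_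
  rw [AddMonoidHom.comp_apply, Chain.map_single, windingChain_single, windingChain_single]
  rfl

/-- Homotopic maps to the circle give the same winding numbers. The homotopy appears in the form
of a lift `h` of the quotient of the two maps. -/
lemma windingHom_eq_of_lift {f g : C(X, Circle)} (h : C(X, ℝ))
    (hfg : ∀ x, f x = Circle.exp (h x) * g x) (c : H1 X Γ) : windingHom f c = windingHom g c := by
  have hk : ∀ x, ∃ k : ℤ, 2 * Real.pi * k = h x - (f x : ℂ).arg + (g x : ℂ).arg := by
    intro x
    obtain ⟨n, hn⟩ := exists_circle_exp_int (Circle.exp_arg (g x))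
      (show Circle.exp (h x + (g x : ℂ).arg) = f x by rw [Circle.exp_add, Circle.exp_arg, hfg])
    exact ⟨n, by linarith⟩
  choose k hk using hk
  obtain ⟨z, rfl⟩ := H1.mk_surjective c
  rw [windingHom, windingHom, H1.pair_mk, H1.pair_mk]
  -- the two cocycles differ by the coboundary of `k`
  suffices H : windingChain f = windingChain g + (Chain.lift (n := 0) fun σ : C(Simplex 0, X) =>
      k (σ (Simplex.vertex 0)) • AddMonoidHom.id Γ).comp (bdry X Γ 0) by
    rw [H, AddMonoidHom.add_apply, AddMonoidHom.comp_apply, z.2, map_zero, add_zero]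
  refine Chain.hom_ext fun σ γ => ?_
  rw [AddMonoidHom.add_apply, AddMonoidHom.comp_apply, bdry_single_one, map_sub,
    Chain.lift_single, Chain.lift_single, windingChain_single, windingChain_single]
  simp only [ContinuousMap.comp_apply, Simplex.face_vertex, AddMonoidHom.smul_apply,
    AddMonoidHom.id_apply]
  rw [← sub_smul, ← add_smul]
  congr 1
  have e1 : (0 : Fin 2).succAbove (0 : Fin 1) = 1 := rfl
  have e2 : (1 : Fin 2).succAbove (0 : Fin 1) = 0 := rfl
  rw [e1, e2]
  obtain ⟨θ, hθ⟩ := exists_circle_lift (g.comp σ)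
  have h1 := two_pi_mul_winding hθ
  have h2 := two_pi_mul_winding (p := f.comp σ) (θ := θ + h.comp σ) (fun a => by
    have := hθ a
    simp only [ContinuousMap.comp_apply] at this
    simp [Circle.exp_add, hfg, this, mul_comm])
  simp only [ContinuousMap.comp_apply, ContinuousMap.add_apply] at h1 h2
  refine two_pi_mul_int_inj ?_
  push_cast
  rw [mul_add, mul_sub, h1, h2, hk, hk]
  ring

lemma mem_slitPlane_of_norm_sub_lt {z w : Circle} (h : ‖(z : ℂ) - w‖ < 2) :
    ((z / w : Circle) : ℂ) ∈ Complex.slitPlane := by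
  rw [Complex.mem_slitPlane_iff_arg]
  refine ⟨fun harg => ?_, Circle.coe_ne_zero _⟩
  have h1 : z / w = Circle.exp Real.pi := by rw [← harg, Circle.exp_arg]
  have h2 : z = Circle.exp Real.pi * w := by rw [← h1, div_mul_cancel]
  have h3 : (z : ℂ) - w = -2 * w := by
    rw [h2, Circle.coe_mul, Circle.coe_exp, Complex.exp_pi_mul_I]
    ring
  rw [h3, norm_mul, Circle.norm_coe] at h
  norm_num at h

lemma continuous_arg_div {A : Type*} [TopologicalSpace A] {f g : A → Circle} (hf : Continuous f)
    (hg : Continuous g) (h : ∀ x, ‖(f x : ℂ) - g x‖ < 2) :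
    Continuous fun x => ((f x / g x : Circle) : ℂ).arg := by
  refine continuous_iff_continuousAt.2 fun x => ?_
  exact ContinuousAt.comp (f := fun x => ((f x / g x : Circle) : ℂ))
    (Complex.continuousAt_arg (mem_slitPlane_of_norm_sub_lt (h x)))
    (continuous_subtype_val.comp (hf.div' hg)).continuousAt

/-- Maps to the circle without antipodal values are homotopic, hence they give the same winding
numbers. -/
lemma windingHom_eq_of_norm_sub_lt {f g : C(X, Circle)} (h : ∀ x, ‖(f x : ℂ) - g x‖ < 2)
    (c : H1 X Γ) : windingHom f c = windingHom g c := by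
  refine windingHom_eq_of_lift ⟨_, continuous_arg_div f.continuous g.continuous h⟩ (fun x => ?_) c
  simp only [ContinuousMap.coe_mk]
  rw [Circle.exp_arg, div_mul_cancel]

end

/-! ### Affine simplices and cocycles -/

section Affine

variable {V : Type*} [AddCommGroup V] [Module ℝ V] [TopologicalSpace V] [ContinuousAdd V]
  [ContinuousSMul ℝ V]

/-- The affine map from the standard simplex with given values at the vertices. -/
def affine {n : ℕ} (v : Fin (n + 1) → V) : C(Simplex n, V) where
  toFun x := ∑ i, x.1 i • v i
  continuous_toFun := continuous_finsetSum _ fun i _ =>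
    ((continuous_apply i).comp continuous_subtype_val).smul continuous_const

lemma affine_comp_face {n : ℕ} (v : Fin (n + 2) → V) (i : Fin (n + 2)) :
    (affine v).comp (Simplex.face i) = affine (v ∘ i.succAbove) := by
  ext x
  change ∑ j, (stdSimplex.map i.succAbove x) j • v j = ∑ j, x j • v (i.succAbove j)
  simp only [stdSimplex.map_coe, FunOnFinite.linearMap_apply_apply, Finset.sum_smul]
  rw [← Finset.sum_fiberwise Finset.univ i.succAbove]
  refine Finset.sum_congr rfl fun j _ => Finset.sum_congr rfl fun k hk => ?_
  rw [(Finset.mem_filter.1 hk).2]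

lemma affine_two_apply (a b : V) (x : Simplex 1) :
    affine ![a, b] x = a + x.1 1 • (b - a) := by
  have h : x.1 0 = 1 - x.1 1 := by
    have := stdSimplex.add_eq_one x
    exact eq_sub_of_add_eq this
  change ∑ i, x.1 i • (![a, b] : Fin 2 → V) i = _
  rw [Fin.sum_univ_two, h]
  simp only [Matrix.cons_val_zero, Matrix.cons_val_one, smul_sub, sub_smul, one_smul]
  abel

variable {X : Type u} [TopologicalSpace X] {Γ : Type u} [AddCommGroup Γ]

/-- The path which traverses the image of the segment from `a` to `b` under `P`. -/
def seg (P : C(V, X)) (a b : V) : C(Simplex 1, X) := P.comp (affine ![a, b])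

lemma seg_apply (P : C(V, X)) (a b : V) (x : Simplex 1) :
    seg P a b x = P (a + x.1 1 • (b - a)) := by
  rw [← affine_two_apply]
  rfl

lemma simplex_one_mem_Icc (x : Simplex 1) : x.1 1 ∈ Icc (0 : ℝ) 1 :=
  mem_Icc_of_mem_stdSimplex x.2 1

variable {M : Type u} [AddCommGroup M] {κ : Chain X Γ 1 →+ M}

/-- A cocycle is additive on subdivided paths. -/
lemma cocycle_seg_add (hκ : ∀ w, κ (bdry X Γ 1 w) = 0) (P : C(V, X)) (a b c : V) (γ : Γ) :
    κ (single (seg P a b) γ) + κ (single (seg P b c) γ) = κ (single (seg P a c) γ) := by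
  have h := hκ (single (P.comp (affine ![a, b, c])) γ)
  rw [bdry_single_two, ContinuousMap.comp_assoc, ContinuousMap.comp_assoc,
    ContinuousMap.comp_assoc, affine_comp_face, affine_comp_face, affine_comp_face, map_add,
    map_sub] at h
  have e0 : (![a, b, c] : Fin 3 → V) ∘ (0 : Fin 3).succAbove = ![b, c] := by
    ext i; fin_cases i <;> rfl
  have e1 : (![a, b, c] : Fin 3 → V) ∘ (1 : Fin 3).succAbove = ![a, c] := by
    ext i; fin_cases i <;> rfl
  have e2 : (![a, b, c] : Fin 3 → V) ∘ (2 : Fin 3).succAbove = ![a, b] := by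
    ext i; fin_cases i <;> rfl
  rw [e0, e1, e2] at h
  change κ (single (seg P b c) γ) - κ (single (seg P a c) γ) + κ (single (seg P a b) γ) = 0 at h
  rw [← sub_eq_zero, ← h]
  abel

lemma cocycle_seg_self (hκ : ∀ w, κ (bdry X Γ 1 w) = 0) (P : C(V, X)) (a : V) (γ : Γ) :
    κ (single (seg P a a) γ) = 0 := by
  have := cocycle_seg_add hκ P a a a γ
  simpa using this

lemma cocycle_const (hκ : ∀ w, κ (bdry X Γ 1 w) = 0) (x : X) (γ : Γ) :
    κ (single (ContinuousMap.const _ x) γ) = 0 :=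
  cocycle_seg_self hκ (ContinuousMap.const ℝ x) 0 γ

lemma cocycle_seg_swap (hκ : ∀ w, κ (bdry X Γ 1 w) = 0) (P : C(V, X)) (a b : V) (γ : Γ) :
    κ (single (seg P b a) γ) = -κ (single (seg P a b) γ) := by
  rw [eq_neg_iff_add_eq_zero, cocycle_seg_add hκ, cocycle_seg_self hκ]

end Affine

/-- A cocycle takes the same value on a path which factors through `E : ℝ → X` as on the path
along `E` with the same end points in `ℝ`, because paths in `ℝ` are homotopic to segments. -/
lemma cocycle_seg_comp {X : Type u} [TopologicalSpace X] {Γ : Type u} [AddCommGroup Γ]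
    {M : Type u} [AddCommGroup M] {κ : Chain X Γ 1 →+ M}
    (hκ : ∀ w, κ (bdry X Γ 1 w) = 0) (E : C(ℝ, X)) (τ : C(ℝ, ℝ)) (a b : ℝ) (γ : Γ) :
    κ (single (seg (E.comp τ) a b) γ) = κ (single (seg E (τ a) (τ b)) γ) := by
  -- `P (s, u, l)` moves from the given path (`u = 0`) to the straight one (`u = 1`)
  let P : C(ℝ × ℝ × ℝ, X) :=
    ⟨fun q => E ((1 - q.2.1) * τ q.1 + q.2.1 * q.2.2), by fun_prop⟩
  have h1 : seg (E.comp τ) a b = seg P (a, 0, τ a) (b, 0, τ b) := by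
    ext x
    simp [seg_apply, P]
  have h2 : seg E (τ a) (τ b) = seg P (a, 1, τ a) (b, 1, τ b) := by
    ext x
    simp [seg_apply, P]
  have h3 : ∀ s, κ (single (seg P (s, 0, τ s) (s, 1, τ s)) γ) = 0 := by
    intro s
    have : seg P (s, 0, τ s) (s, 1, τ s) = ContinuousMap.const _ (E (τ s)) := by
      ext x
      simp only [seg_apply, P, ContinuousMap.coe_mk, ContinuousMap.const_apply]
      congr 1
      simp only [Prod.mk_sub_mk, Prod.smul_mk, Prod.mk_add_mk, sub_self, sub_zero, smul_eq_mul,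
        mul_one, zero_add]
      ring_nf
    rw [this]
    exact cocycle_const hκ _ γ
  have h4 := cocycle_seg_add hκ P (a, 0, τ a) (a, 1, τ a) (b, 1, τ b) γ
  have h5 := cocycle_seg_add hκ P (a, 0, τ a) (b, 0, τ b) (b, 1, τ b) γ
  rw [h3, zero_add] at h4
  rw [h3, add_zero] at h5
  rw [h1, h2, h4, h5]

/-- Every path is of the form `seg p 0 1`. -/
lemma exists_seg_eq {X : Type u} [TopologicalSpace X] (σ : C(Simplex 1, X)) :
    ∃ p : C(ℝ, X), seg p 0 1 = σ ∧ p 0 = σ (Simplex.vertex 0) ∧ p 1 = σ (Simplex.vertex 1) := by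
  let p : C(ℝ, X) := ⟨fun t => σ (stdSimplexHomeomorphUnitInterval.symm
    (projIcc 0 1 zero_le_one t)), by fun_prop⟩
  have hp : ∀ x : Simplex 1, p (x.1 1) = σ x := by
    intro x
    simp only [p, ContinuousMap.coe_mk]
    congr 1
    rw [Homeomorph.symm_apply_eq, projIcc_of_mem _ (simplex_one_mem_Icc x)]
    rfl
  refine ⟨p, ?_, ?_, ?_⟩
  · ext x
    rw [seg_apply, ← hp]
    simp
  · rw [← hp]; simp
  · rw [← hp]; simp

/-! ### The topology of a locally finite 1-complex -/

section Graph

variable (X : Type u) [MetricSpace X] [CWComplex (univ : Set X)]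

/-- The edges of a 1-complex. -/
abbrev Edge : Type u := RelCWComplex.cell (univ : Set X) 1

/-- The set of vertices, as the complement of the open edges. -/
def vertexSet : Set X := {x | ∀ e : Edge X, x ∉ RelCWComplex.openCell 1 e}

variable {X}

/-- The retraction of `ℝ` to `[-1, 1]`. -/
def clamp (a : ℝ) : ℝ := max (-1) (min 1 a)

lemma continuous_clamp : Continuous clamp := by
  unfold clamp
  fun_prop

lemma clamp_mem (a : ℝ) : clamp a ∈ Icc (-1 : ℝ) 1 :=
  ⟨le_max_left _ _, max_le (by norm_num) (min_le_left _ _)⟩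

lemma clamp_of_mem {a : ℝ} (h : a ∈ Icc (-1 : ℝ) 1) : clamp a = a := by
  rw [clamp, min_eq_right h.2, max_eq_right h.1]

lemma const_mem_closedBall {a : ℝ} :
    (fun _ => a : Fin 1 → ℝ) ∈ Metric.closedBall (0 : Fin 1 → ℝ) 1 ↔ a ∈ Icc (-1 : ℝ) 1 := by
  rw [mem_closedBall_zero_iff, Pi.norm_def]
  simp [abs_le]

lemma const_mem_ball {a : ℝ} :
    (fun _ => a : Fin 1 → ℝ) ∈ Metric.ball (0 : Fin 1 → ℝ) 1 ↔ a ∈ Ioo (-1 : ℝ) 1 := by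
  rw [mem_ball_zero_iff, Pi.norm_def]
  simp [abs_lt]

/-- The characteristic map of an edge, extended from `[-1, 1]` to `ℝ` by constants. -/
def edgeMap (e : Edge X) : C(ℝ, X) where
  toFun a := RelCWComplex.map 1 e fun _ => clamp a
  continuous_toFun := (RelCWComplex.continuousOn 1 e).comp_continuous
    (continuous_pi fun _ => continuous_clamp) fun a => const_mem_closedBall.2 (clamp_mem a)

lemma edgeMap_of_mem (e : Edge X) {a : ℝ} (h : a ∈ Icc (-1 : ℝ) 1) :
    edgeMap e a = RelCWComplex.map 1 e fun _ => a := by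
  change RelCWComplex.map 1 e (fun _ => clamp a) = _
  rw [clamp_of_mem h]

lemma edgeMap_clamp (e : Edge X) (a : ℝ) : edgeMap e (clamp a) = edgeMap e a :=
  edgeMap_of_mem e (clamp_mem a)

lemma closedCell_one_eq (e : Edge X) : RelCWComplex.closedCell 1 e = edgeMap e '' Icc (-1) 1 := by
  apply subset_antisymm
  · rintro _ ⟨t, ht, rfl⟩
    have h : t = fun _ => t 0 := by ext i; rw [Subsingleton.elim i 0]
    rw [h, const_mem_closedBall] at ht
    refine ⟨t 0, ht, ?_⟩
    rw [edgeMap_of_mem e ht, ← h]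
  · rintro _ ⟨a, ha, rfl⟩
    exact ⟨_, const_mem_closedBall.2 ha, (edgeMap_of_mem e ha).symm⟩

/-- The parameter in `(-1, 1)` of a point of an open edge. -/
def edgeCoord (e : Edge X) (x : X) : ℝ := (RelCWComplex.map 1 e).symm x 0

lemma edgeMap_mem_openCell (e : Edge X) {a : ℝ} (h : a ∈ Ioo (-1 : ℝ) 1) :
    edgeMap e a ∈ RelCWComplex.openCell 1 e :=
  ⟨_, const_mem_ball.2 h, (edgeMap_of_mem e (Ioo_subset_Icc_self h)).symm⟩

lemma edgeCoord_edgeMap (e : Edge X) {a : ℝ} (h : a ∈ Ioo (-1 : ℝ) 1) :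
    edgeCoord e (edgeMap e a) = a := by
  rw [edgeCoord, edgeMap_of_mem e (Ioo_subset_Icc_self h), (RelCWComplex.map 1 e).left_inv]
  rw [RelCWComplex.source_eq]
  exact const_mem_ball.2 h

lemma exists_edgeMap_eq {e : Edge X} {x : X} (h : x ∈ RelCWComplex.openCell 1 e) :
    ∃ a ∈ Ioo (-1 : ℝ) 1, edgeMap e a = x := by
  obtain ⟨t, ht, rfl⟩ := h
  have h : t = fun _ => t 0 := by ext i; rw [Subsingleton.elim i 0]
  rw [h, const_mem_ball] at ht
  refine ⟨t 0, ht, ?_⟩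
  rw [edgeMap_of_mem e (Ioo_subset_Icc_self ht), ← h]

lemma edgeMap_edgeCoord {e : Edge X} {x : X} (h : x ∈ RelCWComplex.openCell 1 e) :
    edgeMap e (edgeCoord e x) = x := by
  obtain ⟨a, ha, rfl⟩ := exists_edgeMap_eq h
  rw [edgeCoord_edgeMap e ha]

lemma continuousOn_edgeCoord (e : Edge X) :
    ContinuousOn (edgeCoord e) (RelCWComplex.openCell 1 e) := by
  have h : RelCWComplex.openCell 1 e = (RelCWComplex.map 1 e).target := by
    rw [← (RelCWComplex.map 1 e).image_source_eq_target, RelCWComplex.source_eq]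
    rfl
  rw [h]
  exact (continuous_apply 0).comp_continuousOn (RelCWComplex.continuousOn_symm 1 e)

lemma eq_of_mem_openCell {e e' : Edge X} {x : X} (h : x ∈ RelCWComplex.openCell 1 e)
    (h' : x ∈ RelCWComplex.openCell 1 e') : e = e' := by
  have := RelCWComplex.eq_of_not_disjoint_openCell (not_disjoint_iff.2 ⟨x, h, h'⟩)
  simpa using this

lemma mem_vertexSet_or (x : X) : x ∈ vertexSet X ∨ ∃ e : Edge X, ∃ a ∈ Ioo (-1 : ℝ) 1,
    edgeMap e a = x := by
  by_cases h : x ∈ vertexSet X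
  · exact Or.inl h
  · simp only [vertexSet, mem_ofPred_eq, not_forall, not_not] at h
    obtain ⟨e, he⟩ := h
    exact Or.inr ⟨e, exists_edgeMap_eq he⟩

lemma closedCell_zero_subset_vertexSet (v : RelCWComplex.cell (univ : Set X) 0) :
    RelCWComplex.closedCell 0 v ⊆ vertexSet X := by
  rw [RelCWComplex.closedCell_zero_eq_singleton, ← RelCWComplex.openCell_zero_eq_singleton]
  exact fun x hx e => notMem_openCell_one_of_mem_openCell_zero hx e

lemma edgeMap_mem_vertexSet (e : Edge X) {a : ℝ} (h : |a| = 1) : edgeMap e a ∈ vertexSet X := by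
  have hI : a ∈ Icc (-1 : ℝ) 1 := abs_le.1 h.le
  have hfr : edgeMap e a ∈ RelCWComplex.cellFrontier 1 e := by
    refine ⟨fun _ => a, ?_, (edgeMap_of_mem e hI).symm⟩
    rw [mem_sphere_zero_iff_norm, Pi.norm_def]
    simp [h]
  obtain ⟨v, w, hvw⟩ := CWComplex.exists_cellFrontier_one_eq e
  rw [hvw] at hfr
  exact hfr.elim (fun h => closedCell_zero_subset_vertexSet v h)
    (fun h => closedCell_zero_subset_vertexSet w h)

lemma mem_Ioo_or_abs_eq {a : ℝ} (h : a ∈ Icc (-1 : ℝ) 1) : a ∈ Ioo (-1 : ℝ) 1 ∨ |a| = 1 := by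
  rcases (abs_le.2 h).lt_or_eq with h | h
  · exact Or.inl (abs_lt.1 h)
  · exact Or.inr h

lemma edgeMap_notMem_openCell {e e' : Edge X} (h : e' ≠ e) (a : ℝ) :
    edgeMap e' a ∉ RelCWComplex.openCell 1 e := by
  rw [← edgeMap_clamp]
  rcases mem_Ioo_or_abs_eq (clamp_mem a) with ha | ha
  · exact fun hx => h (eq_of_mem_openCell (edgeMap_mem_openCell e' ha) hx)
  · exact edgeMap_mem_vertexSet e' ha e

variable [LocallyFiniteMetricOneComplex X]

lemma exists_closedCell_zero_of_mem_vertexSet {x : X} (hx : x ∈ vertexSet X) :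
    ∃ v : RelCWComplex.cell (univ : Set X) 0, RelCWComplex.closedCell 0 v = {x} := by
  have h : x ∈ ⋃ (n : ℕ) (j : RelCWComplex.cell (univ : Set X) n), RelCWComplex.openCell n j := by
    rw [CWComplex.iUnion_openCell_eq_complex]
    exact mem_univ x
  simp only [mem_iUnion] at h
  obtain ⟨n, j, hj⟩ := h
  match n, j, hj with
  | 0, j, hj =>
    refine ⟨j, ?_⟩
    rw [RelCWComplex.openCell_zero_eq_singleton] at hj
    rw [RelCWComplex.closedCell_zero_eq_singleton, mem_singleton_iff.1 hj]
  | 1, j, hj => exact (hx j hj).elim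
  | n + 2, j, hj =>
    exact ((LocallyFiniteMetricOneComplex.isEmpty_cell (X := X) (n + 2) (by lia)).false j).elim

/-- The vertex set is closed and discrete: all of its subsets are closed, by local finiteness. -/
lemma isClosed_of_subset_vertexSet {A : Set X} (hA : A ⊆ vertexSet X) : IsClosed A := by
  let I := {c : Σ n, RelCWComplex.cell (univ : Set X) n // RelCWComplex.closedCell c.1 c.2 ⊆ A}
  have h : A = ⋃ c : I, RelCWComplex.closedCell c.1.1 c.1.2 := by
    apply subset_antisymm
    · intro x hx
      obtain ⟨v, hv⟩ := exists_closedCell_zero_of_mem_vertexSet (hA hx)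
      refine mem_iUnion.2 ⟨⟨⟨0, v⟩, ?_⟩, ?_⟩
      · simpa [hv] using hx
      · simp [hv]
    · exact iUnion_subset fun c => c.2
  rw [h]
  exact (LocallyFiniteMetricOneComplex.locallyFinite.comp_injective
    Subtype.val_injective).isClosed_iUnion fun c => RelCWComplex.isClosed_closedCell

lemma locallyFinite_closedCell_one :
    LocallyFinite fun e : Edge X => RelCWComplex.closedCell 1 e :=
  LocallyFiniteMetricOneComplex.locallyFinite.comp_injective sigma_mk_injective

lemma isOpen_openCell_one (e : Edge X) : IsOpen (RelCWComplex.openCell 1 e) := by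
  have h : (RelCWComplex.openCell 1 e)ᶜ =
      vertexSet X ∪ ⋃ e' : {e' // e' ≠ e}, RelCWComplex.closedCell 1 e'.1 := by
    apply subset_antisymm
    · intro x hx
      rcases mem_vertexSet_or x with h | ⟨e', a, ha, rfl⟩
      · exact Or.inl h
      · refine Or.inr (mem_iUnion.2 ⟨⟨e', ?_⟩, RelCWComplex.openCell_subset_closedCell _ _
          (edgeMap_mem_openCell e' ha)⟩)
        rintro rfl
        exact hx (edgeMap_mem_openCell e' ha)
    · rintro x (hx | hx)
      · exact hx e
      · obtain ⟨e', hx⟩ := mem_iUnion.1 hx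
        rw [closedCell_one_eq] at hx
        obtain ⟨a, -, rfl⟩ := hx
        exact edgeMap_notMem_openCell e'.2 a
  rw [← isClosed_compl_iff, h]
  exact (isClosed_of_subset_vertexSet subset_rfl).union
    ((locallyFinite_closedCell_one.comp_injective Subtype.val_injective).isClosed_iUnion
      fun c => RelCWComplex.isClosed_closedCell)

/-- A map on the product of a locally finite 1-complex with a space is continuous if it is so on
each edge and on each vertex, since the closed cells form a locally finite closed cover and the
characteristic maps are proper. -/
lemma continuous_of_edges {T Z : Type*} [TopologicalSpace T] [TopologicalSpace Z] {f : X × T → Z}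
    (hv : ∀ x ∈ vertexSet X, Continuous fun t => f (x, t))
    (he : ∀ e : Edge X, Continuous fun p : ℝ × T => f (edgeMap e p.1, p.2)) : Continuous f := by
  refine (LocallyFiniteMetricOneComplex.locallyFinite.preimage_continuous
    (continuous_fst (X := X) (Y := T))).continuous ?_ (fun c =>
      RelCWComplex.isClosed_closedCell.preimage continuous_fst) ?_
  · refine eq_univ_of_forall fun p => ?_
    have : p.1 ∈ ⋃ (n : ℕ) (j : RelCWComplex.cell (univ : Set X) n),
        RelCWComplex.closedCell n j := by
      rw [CWComplex.union]
      exact mem_univ _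
    simp only [mem_iUnion] at this
    obtain ⟨n, j, hj⟩ := this
    exact mem_iUnion.2 ⟨⟨n, j⟩, hj⟩
  · rintro ⟨n, j⟩
    match n, j with
    | 0, v =>
      have hx := closedCell_zero_subset_vertexSet v
      rw [RelCWComplex.closedCell_zero_eq_singleton] at hx
      have := (hv _ (hx rfl)).comp (continuous_snd (X := X) (Y := T))
      refine this.continuousOn.congr fun p hp => ?_
      have hp : p.1 ∈ RelCWComplex.closedCell 0 v := hp
      rw [RelCWComplex.closedCell_zero_eq_singleton, mem_singleton_iff] at hp
      simp only [Function.comp_apply, ← hp]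
    | 1, e =>
      let k : Icc (-1 : ℝ) 1 → X := fun a => edgeMap e a
      have hk : Continuous k := (edgeMap e).continuous.comp continuous_subtype_val
      have hπ : IsProperMap (Prod.map k (id : T → T)) := hk.isProperMap.prodMap isProperMap_id
      have hr : Prod.fst ⁻¹' RelCWComplex.closedCell 1 e = range (Prod.map k (id : T → T)) := by
        rw [closedCell_one_eq]
        ext ⟨x, t⟩
        constructor
        · rintro ⟨a, ha, rfl⟩
          exact ⟨(⟨a, ha⟩, t), rfl⟩
        · rintro ⟨⟨a, t'⟩, h⟩
          exact ⟨a, a.2, congrArg Prod.fst h⟩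
      have hc : Continuous (f ∘ Prod.map k (id : T → T)) :=
        (he e).comp (by fun_prop : Continuous fun p : Icc (-1 : ℝ) 1 × T => (p.1.1, p.2))
      rw [hr, continuousOn_iff_isClosed]
      intro s hs
      refine ⟨_, hπ.isClosedMap _ (hs.preimage hc), ?_⟩
      rw [preimage_comp, image_preimage_eq_inter_range, inter_assoc, inter_self]
    | n + 2, j =>
      exact ((LocallyFiniteMetricOneComplex.isEmpty_cell (X := X) (n + 2) (by lia)).false j).elim

end Graph

/-! ### The first homology group of a locally finite 1-complex -/

section Graph

variable {X : Type u} [MetricSpace X] [CWComplex (univ : Set X)]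

open Classical in
/-- The map to the circle which wraps the edge `e` once around the circle and is constant outside
`e`, as a function. -/
def edgeCircleFun (e : Edge X) (x : X) : Circle :=
  if x ∈ RelCWComplex.openCell 1 e then Circle.exp (Real.pi * (1 + edgeCoord e x)) else 1

lemma edgeCircleFun_edgeMap_self (e : Edge X) (a : ℝ) :
    edgeCircleFun e (edgeMap e a) = Circle.exp (Real.pi * (1 + clamp a)) := by
  rw [← edgeMap_clamp]
  rcases mem_Ioo_or_abs_eq (clamp_mem a) with ha | ha
  · rw [edgeCircleFun, if_pos (edgeMap_mem_openCell e ha), edgeCoord_edgeMap e ha]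
  · rw [edgeCircleFun, if_neg (edgeMap_mem_vertexSet e ha e)]
    rcases (abs_eq zero_le_one).1 ha with h | h
    · rw [h, show Real.pi * (1 + 1) = 2 * Real.pi by ring, Circle.exp_two_pi]
    · rw [h]; simp

lemma edgeCircleFun_edgeMap_of_ne {e e' : Edge X} (h : e' ≠ e) (a : ℝ) :
    edgeCircleFun e (edgeMap e' a) = 1 := by
  rw [edgeCircleFun, if_neg (edgeMap_notMem_openCell h a)]

/-- The map to the circle which wraps the edge `e` once around the circle and is constant outside
`e`, as a continuous map. -/
def edgeCircle [LocallyFiniteMetricOneComplex X] (e : Edge X) : C(X, Circle) where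
  toFun := edgeCircleFun e
  continuous_toFun := by
    have : Continuous fun p : X × Unit => edgeCircleFun e p.1 := by
      refine continuous_of_edges (fun x _ => continuous_const (y := edgeCircleFun e x)) fun e' => ?_
      by_cases h : e' = e
      · subst h
        simp only [edgeCircleFun_edgeMap_self]
        have := continuous_clamp
        fun_prop
      · simp only [edgeCircleFun_edgeMap_of_ne h]
        exact continuous_const
    exact this.comp (by fun_prop : Continuous fun x : X => (x, ()))

open Classical in
/-- The deformation of a 1-complex which stretches each edge away from its centre by the factor
`1 + |u|`. At `u = 1` it maps the outer halves of the edges to the vertices. -/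
def stretchFun (x : X) (u : ℝ) : X :=
  if h : ∃ e : Edge X, x ∈ RelCWComplex.openCell 1 e then
    edgeMap h.choose ((1 + |u|) * edgeCoord h.choose x) else x

lemma stretchFun_of_mem_vertexSet {x : X} (hx : x ∈ vertexSet X) (u : ℝ) : stretchFun x u = x := by
  rw [stretchFun, dif_neg]
  rintro ⟨e, he⟩
  exact hx e he

lemma stretchFun_edgeMap (e : Edge X) (a u : ℝ) :
    stretchFun (edgeMap e a) u = edgeMap e ((1 + |u|) * clamp a) := by
  rw [← edgeMap_clamp]
  have hu := abs_nonneg u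
  rcases mem_Ioo_or_abs_eq (clamp_mem a) with ha | ha
  · have h : ∃ e' : Edge X, edgeMap e (clamp a) ∈ RelCWComplex.openCell 1 e' :=
      ⟨e, edgeMap_mem_openCell e ha⟩
    have hch : h.choose = e := eq_of_mem_openCell h.choose_spec (edgeMap_mem_openCell e ha)
    rw [stretchFun, dif_pos h, hch, edgeCoord_edgeMap e ha]
  · rw [stretchFun_of_mem_vertexSet (edgeMap_mem_vertexSet e ha), ← edgeMap_clamp e (_ * _)]
    congr 1
    rcases (abs_eq zero_le_one).1 ha with h | h
    · rw [h, clamp, min_eq_left (by linarith)]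
      norm_num
    · rw [h, clamp, min_eq_right (by linarith), max_eq_left (by linarith)]

/-- The deformation `stretchFun`, as a continuous map. -/
def stretch [LocallyFiniteMetricOneComplex X] : C(X × ℝ, X) where
  toFun p := stretchFun p.1 p.2
  continuous_toFun := by
    refine continuous_of_edges (fun x hx => ?_) fun e => ?_
    · simp only [stretchFun_of_mem_vertexSet hx]
      exact continuous_const
    · simp only [stretchFun_edgeMap]
      have := continuous_clamp
      fun_prop

lemma stretchFun_zero (x : X) : stretchFun x 0 = x := by
  rcases mem_vertexSet_or x with h | ⟨e, a, ha, rfl⟩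
  · exact stretchFun_of_mem_vertexSet h 0
  · rw [stretchFun_edgeMap]
    simp [edgeMap_clamp]

/-- At `u = 1`, the deformation maps a neighbourhood of a vertex to this vertex. -/
lemma eventually_stretchFun_one_eq [LocallyFiniteMetricOneComplex X] {x : X}
    (hx : x ∈ vertexSet X) : ∀ᶠ y in 𝓝 x, stretchFun y 1 = x := by
  -- the middle halves of the edges
  set C : Set X := ⋃ e : Edge X, edgeMap e '' Icc (-(1 / 2)) (1 / 2) with hC
  have hCc : IsClosed C := by
    refine LocallyFinite.isClosed_iUnion (locallyFinite_closedCell_one.subset fun e => ?_)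
      fun e => (isCompact_Icc.image (edgeMap e).continuous).isClosed
    rw [closedCell_one_eq]
    exact image_mono (Icc_subset_Icc (by norm_num) (by norm_num))
  have hxC : x ∉ C := by
    intro h
    obtain ⟨e, a, ha, rfl⟩ := mem_iUnion.1 h
    exact hx e (edgeMap_mem_openCell e ⟨by linarith [ha.1], by linarith [ha.2]⟩)
  -- near `x` the deformed point is a vertex (outside `C`), and no vertex other than `x`
  have hAc : IsClosed (vertexSet X \ {x}) := isClosed_of_subset_vertexSet sdiff_subset
  have hcont : Continuous fun y : X => stretchFun y 1 :=
    stretch.continuous.comp (by fun_prop : Continuous fun y : X => (y, (1 : ℝ)))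
  have h1 : ∀ᶠ y in 𝓝 x, stretchFun y 1 ∉ vertexSet X \ {x} := by
    refine hcont.continuousAt.eventually (hAc.isOpen_compl.mem_nhds ?_)
    simp [stretchFun_of_mem_vertexSet hx]
  filter_upwards [h1, hCc.isOpen_compl.mem_nhds hxC] with y hy1 hy2
  have hy : stretchFun y 1 ∈ vertexSet X := by
    rcases mem_vertexSet_or y with h | ⟨e, a, ha, rfl⟩
    · rwa [stretchFun_of_mem_vertexSet h]
    · rw [stretchFun_edgeMap, ← edgeMap_clamp, clamp_of_mem (Ioo_subset_Icc_self ha), abs_one]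
      have : a < -(1 / 2) ∨ 1 / 2 < a := by
        by_contra! h
        exact hy2 (mem_iUnion.2 ⟨e, a, h, rfl⟩)
      refine edgeMap_mem_vertexSet e ?_
      rcases this with h | h
      · rw [clamp, min_eq_right (by linarith), max_eq_left (by linarith)]
        norm_num
      · rw [clamp, min_eq_left (by linarith)]
        norm_num
  by_contra hne
  exact hy1 ⟨hy, hne⟩

open Classical in
/-- A path from a vertex to the point `x` along the edge which contains `x`. -/
def spoke (x : X) : C(Simplex 1, X) :=
  if h : ∃ e : Edge X, x ∈ RelCWComplex.openCell 1 e then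
    seg (edgeMap h.choose) (-1) (edgeCoord h.choose x) else ContinuousMap.const _ x

lemma spoke_of_mem_vertexSet {x : X} (hx : x ∈ vertexSet X) :
    spoke x = ContinuousMap.const _ x := by
  rw [spoke, dif_neg]
  rintro ⟨e, he⟩
  exact hx e he

lemma spoke_edgeMap (e : Edge X) {a : ℝ} (ha : a ∈ Ioo (-1 : ℝ) 1) :
    spoke (edgeMap e a) = seg (edgeMap e) (-1) a := by
  have h : ∃ e' : Edge X, edgeMap e a ∈ RelCWComplex.openCell 1 e' :=
    ⟨e, edgeMap_mem_openCell e ha⟩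
  have hch : h.choose = e := eq_of_mem_openCell h.choose_spec (edgeMap_mem_openCell e ha)
  rw [spoke, dif_pos h, hch, edgeCoord_edgeMap e ha]

/-- The characteristic map of an edge, as a singular simplex. -/
def edgeSimplex (e : Edge X) : C(Simplex 1, X) := seg (edgeMap e) (-1) 1

variable {Γ : Type u} [AddCommGroup Γ] {M : Type u} [AddCommGroup M] {κ : Chain X Γ 1 →+ M}

/-- The hypothesis `hE` is needed at `a = 1` only, where the spoke is constant but the path is the
whole edge. -/
lemma cocycle_spoke_edgeMap (hκ : ∀ w, κ (bdry X Γ 1 w) = 0)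
    (hE : ∀ e γ, κ (single (edgeSimplex e) γ) = 0) (e : Edge X) {a : ℝ}
    (ha : a ∈ Icc (-1 : ℝ) 1) (γ : Γ) :
    κ (single (seg (edgeMap e) (-1) a) γ) = κ (single (spoke (edgeMap e a)) γ) := by
  rcases mem_Ioo_or_abs_eq ha with h | h
  · rw [spoke_edgeMap e h]
  · rw [spoke_of_mem_vertexSet (edgeMap_mem_vertexSet e h), cocycle_const hκ]
    rcases (abs_eq zero_le_one).1 h with h | h
    · rw [h]; exact hE e γ
    · rw [h, cocycle_seg_self hκ]

/-- On a path inside an edge, a cocycle which vanishes on the edges is the coboundary of its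
values on the spokes. -/
lemma cocycle_seg_edgeMap_comp (hκ : ∀ w, κ (bdry X Γ 1 w) = 0)
    (hE : ∀ e γ, κ (single (edgeSimplex e) γ) = 0) (e : Edge X) (τ : C(ℝ, ℝ)) (a b : ℝ) (γ : Γ) :
    κ (single (seg ((edgeMap e).comp τ) a b) γ) =
      κ (single (spoke (edgeMap e (τ b))) γ) - κ (single (spoke (edgeMap e (τ a))) γ) := by
  have h : (edgeMap e).comp τ = (edgeMap e).comp (⟨fun s => clamp (τ s),
      continuous_clamp.comp τ.continuous⟩ : C(ℝ, ℝ)) := by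
    ext s
    exact (edgeMap_clamp e (τ s)).symm
  rw [h, cocycle_seg_comp hκ, ← edgeMap_clamp e (τ a), ← edgeMap_clamp e (τ b),
    ← cocycle_spoke_edgeMap hκ hE e (clamp_mem _), ← cocycle_spoke_edgeMap hκ hE e (clamp_mem _),
    eq_sub_iff_add_eq']
  exact cocycle_seg_add hκ _ _ _ _ γ

variable [LocallyFiniteMetricOneComplex X]

/-- The track of a point under the deformation `stretch` stays in an edge, or is constant. -/
lemma cocycle_seg_stretch (hκ : ∀ w, κ (bdry X Γ 1 w) = 0)
    (hE : ∀ e γ, κ (single (edgeSimplex e) γ) = 0) (p : C(ℝ, X)) (t : ℝ) (γ : Γ) :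
    κ (single (seg (stretch.comp (p.prodMap (ContinuousMap.id ℝ))) (t, 0) (t, 1)) γ) =
      κ (single (spoke (stretchFun (p t) 1)) γ) - κ (single (spoke (p t)) γ) := by
  rcases mem_vertexSet_or (p t) with h | ⟨e, a, ha, h⟩
  · rw [stretchFun_of_mem_vertexSet h, sub_self]
    have : seg (stretch.comp (p.prodMap (ContinuousMap.id ℝ))) (t, 0) (t, 1) =
        ContinuousMap.const _ (p t) := by
      ext x
      simp [seg_apply, stretch, stretchFun_of_mem_vertexSet h]
    rw [this, cocycle_const hκ]
  · have : seg (stretch.comp (p.prodMap (ContinuousMap.id ℝ))) (t, 0) (t, 1) =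
        seg ((edgeMap e).comp (⟨fun u => (1 + |u|) * clamp a, by fun_prop⟩ : C(ℝ, ℝ))) 0 1 := by
      ext x
      simp [seg_apply, stretch, ← h, stretchFun_edgeMap]
    rw [this, cocycle_seg_edgeMap_comp hκ hE, ← h, stretchFun_edgeMap]
    simp [edgeMap_clamp]

/-- The local form of `cocycle_seg_eq`. Near a time at which the path is inside an edge, it stays in
this edge; near a time at which it is at a vertex, `stretch` deforms it to that vertex. -/
lemma cocycle_seg_eventually (hκ : ∀ w, κ (bdry X Γ 1 w) = 0)
    (hE : ∀ e γ, κ (single (edgeSimplex e) γ) = 0) (p : C(ℝ, X)) (γ : Γ) (t : ℝ) :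
    ∀ᶠ t' in 𝓝 t, κ (single (seg p t t') γ) =
      κ (single (spoke (p t')) γ) - κ (single (spoke (p t)) γ) := by
  have hball : ∀ {A : Set X}, A ∈ 𝓝 (p t) → ∃ δ > 0, ∀ s ∈ Icc (t - δ) (t + δ), p s ∈ A := by
    intro A hA
    obtain ⟨δ, hδ, h⟩ := Metric.nhds_basis_closedBall.mem_iff.1 (p.continuous.continuousAt hA)
    exact ⟨δ, hδ, fun s hs => h (by rwa [Real.closedBall_eq_Icc])⟩
  have hseg : ∀ {δ t' : ℝ}, 0 < δ → t' ∈ Icc (t - δ) (t + δ) → ∀ x : Simplex 1,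
      t + x.1 1 * (t' - t) ∈ Icc (t - δ) (t + δ) := by
    intro δ t' hδ ht' x
    have := simplex_one_mem_Icc x
    constructor <;> nlinarith [this.1, this.2, ht'.1, ht'.2]
  rcases mem_vertexSet_or (p t) with hv | ⟨e, a, ha, hea⟩
  · obtain ⟨δ, hδ, hp⟩ := hball (eventually_stretchFun_one_eq hv)
    filter_upwards [Icc_mem_nhds (sub_lt_self t hδ) (lt_add_of_pos_right t hδ)] with t' ht'
    set P := stretch.comp (p.prodMap (ContinuousMap.id ℝ)) with hP
    have h0 : seg p t t' = seg P (t, 0) (t', 0) := by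
      ext x
      simp [seg_apply, P, stretch, stretchFun_zero]
    have h1 : seg P (t, 1) (t', 1) = ContinuousMap.const _ (p t) := by
      ext x
      have := hp _ (hseg hδ ht' x)
      simp only [mem_ofPred_eq] at this
      simp [seg_apply, P, stretch, this]
    have h2 := cocycle_seg_add hκ P (t, 0) (t, 1) (t', 1) γ
    have h3 := cocycle_seg_add hκ P (t, 0) (t', 0) (t', 1) γ
    have h4 : stretchFun (p t') 1 = p t := hp _ ht'
    rw [h1, cocycle_const hκ, add_zero, ← h3, ← h0, cocycle_seg_stretch hκ hE,
      cocycle_seg_stretch hκ hE, stretchFun_of_mem_vertexSet hv, h4, sub_self] at h2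
    rw [eq_comm, ← sub_eq_zero] at h2
    rw [← sub_eq_zero, ← h2]
    abel
  · have hA : RelCWComplex.openCell 1 e ∈ 𝓝 (p t) :=
      (isOpen_openCell_one e).mem_nhds (hea ▸ edgeMap_mem_openCell e ha)
    obtain ⟨δ, hδ, hp⟩ := hball hA
    filter_upwards [Icc_mem_nhds (sub_lt_self t hδ) (lt_add_of_pos_right t hδ)] with t' ht'
    have hle : t - δ ≤ t + δ := by linarith
    let τ : C(ℝ, ℝ) := ⟨fun s => edgeCoord e (p (projIcc _ _ hle s)),
      (continuousOn_edgeCoord e).comp_continuous (by fun_prop) fun s =>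
        hp _ (projIcc (t - δ) (t + δ) hle s).2⟩
    have hτ : ∀ s ∈ Icc (t - δ) (t + δ), edgeMap e (τ s) = p s := by
      intro s hs
      simp only [τ, ContinuousMap.coe_mk, projIcc_of_mem hle hs]
      exact edgeMap_edgeCoord (hp s hs)
    have h : seg p t t' = seg ((edgeMap e).comp τ) t t' := by
      ext x
      simp only [seg_apply, ContinuousMap.comp_apply, smul_eq_mul]
      rw [hτ _ (hseg hδ ht' x)]
    rw [h, cocycle_seg_edgeMap_comp hκ hE, hτ _ ht', hτ t ⟨by linarith, by linarith⟩]

/-- On every path, a cocycle which vanishes on the edges is the coboundary of its values on the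
spokes. -/
lemma cocycle_seg_eq (hκ : ∀ w, κ (bdry X Γ 1 w) = 0)
    (hE : ∀ e γ, κ (single (edgeSimplex e) γ) = 0) (p : C(ℝ, X)) (γ : Γ) (s t : ℝ) :
    κ (single (seg p s t) γ) = κ (single (spoke (p t)) γ) - κ (single (spoke (p s)) γ) := by
  refine isPreconnected_univ.induction₂ (fun s t : ℝ => κ (single (seg p s t) γ) =
      κ (single (spoke (p t)) γ) - κ (single (spoke (p s)) γ)) ?_ ?_ ?_ (mem_univ s) (mem_univ t)
  · intro x _
    rw [nhdsWithin_univ]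
    exact cocycle_seg_eventually hκ hE p γ x
  · intro x y z _ _ _ h1 h2
    rw [← cocycle_seg_add hκ p x y z, h1, h2]
    abel
  · intro x y _ _ h
    rw [cocycle_seg_swap hκ, h, neg_sub]

/-- A cocycle on a 1-complex which vanishes on the edges is a coboundary, hence it vanishes on
all cycles. -/
lemma cocycle_eq_zero (hκ : ∀ w, κ (bdry X Γ 1 w) = 0)
    (hE : ∀ e γ, κ (single (edgeSimplex e) γ) = 0) (z : Chain X Γ 1) (hz : bdry X Γ 0 z = 0) :
    κ z = 0 := by
  have h : κ = (Chain.lift (n := 0) fun σ : C(Simplex 0, X) =>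
      κ.comp (single (spoke (σ (Simplex.vertex 0))))).comp (bdry X Γ 0) := by
    refine Chain.hom_ext fun σ γ => ?_
    obtain ⟨p, hp, hp0, hp1⟩ := exists_seg_eq σ
    rw [AddMonoidHom.comp_apply, bdry_single_one, map_sub, Chain.lift_single, Chain.lift_single,
      ContinuousMap.comp_apply, ContinuousMap.comp_apply, Simplex.face_vertex,
      Simplex.face_vertex, ← hp, cocycle_seg_eq hκ hE, hp, hp0, hp1]
    rfl
  rw [h, AddMonoidHom.comp_apply, hz, map_zero]

lemma winding_edgeCircle_self (e : Edge X) :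
    winding ((edgeCircle e).comp (edgeSimplex e)) = 1 := by
  let θ : C(Simplex 1, ℝ) := ⟨fun x => 2 * Real.pi * x.1 1,
    continuous_const.mul ((continuous_apply 1).comp continuous_subtype_val)⟩
  have h : ∀ x, Circle.exp (θ x) = (edgeCircle e).comp (edgeSimplex e) x := by
    intro x
    have hx := simplex_one_mem_Icc x
    have hmem : -1 + x.1 1 * (1 - -1) ∈ Icc (-1 : ℝ) 1 :=
      ⟨by linarith [hx.1], by linarith [hx.2]⟩
    simp only [ContinuousMap.comp_apply, edgeSimplex, seg_apply, smul_eq_mul]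
    refine Eq.trans ?_ (edgeCircleFun_edgeMap_self e _).symm
    rw [clamp_of_mem hmem]
    congr 1
    simp only [θ, ContinuousMap.coe_mk]
    ring
  have := two_pi_mul_winding h
  rw [← h, ← h] at this
  refine two_pi_mul_int_inj (this.trans ?_)
  simp [θ, Circle.exp_two_pi]

lemma winding_edgeCircle_of_ne {e e' : Edge X} (h : e' ≠ e) :
    winding ((edgeCircle e).comp (edgeSimplex e')) = 0 := by
  have h : ∀ x, Circle.exp ((0 : C(Simplex 1, ℝ)) x) = (edgeCircle e).comp (edgeSimplex e') x := by
    intro x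
    refine Eq.trans ?_ (edgeCircleFun_edgeMap_of_ne h _).symm
    simp
  have := two_pi_mul_winding h
  rw [← h, ← h] at this
  refine two_pi_mul_int_inj (this.trans ?_)
  simp

/-- A class in `H₁` of a 1-complex vanishes if it winds zero times around each edge. -/
theorem eq_zero_of_windingHom_edgeCircle (c : H1 X Γ)
    (h : ∀ e : Edge X, windingHom (edgeCircle e) c = 0) : c = 0 := by
  classical
  obtain ⟨z, rfl⟩ := H1.mk_surjective c
  -- the chains which are supported on the edges
  let ε : (Edge X →₀ Γ) →+ Chain X Γ 1 := Finsupp.liftAddHom fun e => single (edgeSimplex e)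
  have hε : ∀ (e : Edge X) (y : Edge X →₀ Γ), windingChain (edgeCircle e) (ε y) = y e := by
    intro e y
    suffices H : (windingChain (edgeCircle e)).comp ε = Finsupp.applyAddHom e from
      DFunLike.congr_fun H y
    refine Finsupp.addHom_ext fun e' γ => ?_
    rw [AddMonoidHom.comp_apply, Finsupp.liftAddHom_apply_single, windingChain_single,
      Finsupp.applyAddHom_apply, Finsupp.single_apply]
    split_ifs with he
    · rw [he, winding_edgeCircle_self, one_smul]
    · rw [winding_edgeCircle_of_ne he, zero_smul]
  -- by `cocycle_eq_zero` for the projection to the quotient by `S`, every cycle lies in `S`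
  let S : AddSubgroup (Chain X Γ 1) := (bdry X Γ 1).range ⊔ ε.range
  have hzS : z.1 ∈ S := by
    rw [← QuotientAddGroup.eq_zero_iff]
    refine cocycle_eq_zero (κ := QuotientAddGroup.mk' S) (fun w => ?_) (fun e γ => ?_) z.1 z.2
    · exact (QuotientAddGroup.eq_zero_iff _).2 (AddSubgroup.mem_sup_left ⟨w, rfl⟩)
    · refine (QuotientAddGroup.eq_zero_iff _).2 (AddSubgroup.mem_sup_right
        ⟨Finsupp.single e γ, Finsupp.liftAddHom_apply_single _ _ _⟩)
  obtain ⟨_, ⟨w, rfl⟩, _, ⟨y, rfl⟩, hwy⟩ := AddSubgroup.mem_sup.1 hzS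
  have hy : y = 0 := by
    ext e
    have := h e
    rwa [windingHom, H1.pair_mk, ← hwy, map_add, windingChain_bdry, zero_add, hε] at this
  refine H1.mk_eq_zero z w ?_
  rw [← hwy, hy, map_zero, add_zero]

end Graph

/-! ### Level sets of small length -/

section Levels

lemma exists_cover_of_area_lt {Y : Type u} [MetricSpace Y] {s : Set Y} {ε : ℝ≥0∞}
    (h : area s < ε) : ∃ U : ℕ → Set Y, s ⊆ ⋃ n, U n ∧ ∑' n, Metric.ediam (U n) ^ 2 < ε := by
  let : MeasurableSpace Y := borel Y
  have : BorelSpace Y := ⟨rfl⟩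
  have h' : Measure.hausdorffMeasure 2 s < ε := h
  rw [Measure.hausdorffMeasure_apply] at h'
  have h1 := (le_iSup₂ (f := fun (r : ℝ≥0∞) (_ : 0 < r) =>
    ⨅ (t : ℕ → Set Y) (_ : s ⊆ ⋃ n, t n) (_ : ∀ n, Metric.ediam (t n) ≤ r),
      ∑' n, ⨆ _ : (t n).Nonempty, Metric.ediam (t n) ^ (2 : ℝ)) 1 one_pos).trans_lt h'
  simp only [iInf_lt_iff] at h1
  obtain ⟨U, hU, -, hlt⟩ := h1
  refine ⟨U, hU, lt_of_le_of_lt (ENNReal.tsum_le_tsum fun n => ?_) hlt⟩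
  rcases (U n).eq_empty_or_nonempty with hn | hn
  · simp [hn]
  · refine le_iSup_of_le hn ?_
    rw [← ENNReal.rpow_natCast]
    norm_num

lemma volume_image_le_ediam {Y : Type*} [PseudoMetricSpace Y] {u : Y → ℝ} (hu : LipschitzWith 1 u)
    (s : Set Y) : volume (u '' s) ≤ Metric.ediam s := by
  refine (Real.volume_le_diam _).trans ((hu.ediam_image_le s).trans ?_)
  simp

/-- A form of the coarea inequality: if the sum of the squares of the diameters of the sets `U n`
is less than `r * η`, then a 1-Lipschitz function has a level in `(0, r)` such that the sum
of the diameters of the sets `U n` which meet the level set is less than `η`. -/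
lemma exists_level {Y : Type*} [PseudoMetricSpace Y] {u : Y → ℝ} (hu : LipschitzWith 1 u)
    (U : ℕ → Set Y) {r : ℝ} {η : ℝ≥0∞}
    (hU : ∑' n, Metric.ediam (U n) ^ 2 < η * ENNReal.ofReal r) :
    ∃ s ∈ Ioo 0 r, ∑' n, Metric.ediam (U n ∩ u ⁻¹' {s}) < η := by
  set J : ℕ → Set ℝ := fun n => toMeasurable volume (u '' U n) with hJ
  have hJm : ∀ n, MeasurableSet (J n) := fun n => measurableSet_toMeasurable _ _
  set f : ℕ → ℝ → ℝ≥0∞ := fun n => (J n).indicator fun _ => Metric.ediam (U n) with hf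
  have hle : ∀ n s, Metric.ediam (U n ∩ u ⁻¹' {s}) ≤ f n s := by
    intro n s
    rcases (U n ∩ u ⁻¹' {s}).eq_empty_or_nonempty with h | ⟨y, hy, hys⟩
    · rw [h]; simp
    · have hs : s ∈ J n := subset_toMeasurable _ _ ⟨y, hy, hys⟩
      rw [hf]
      simp only [indicator_of_mem hs]
      exact Metric.ediam_mono inter_subset_left
  by_contra! hcon
  have h1 : η * ENNReal.ofReal r ≤ ∫⁻ s in Ioo 0 r, ∑' n, f n s := by
    calc η * ENNReal.ofReal r = ∫⁻ _ in Ioo 0 r, η := by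
          rw [setLIntegral_const, Real.volume_Ioo, sub_zero]
      _ ≤ ∫⁻ s in Ioo 0 r, ∑' n, f n s :=
          setLIntegral_mono' measurableSet_Ioo fun s hs =>
            (hcon s hs).trans (ENNReal.tsum_le_tsum fun n => hle n s)
  have h2 : ∫⁻ s in Ioo 0 r, ∑' n, f n s ≤ ∑' n, Metric.ediam (U n) ^ 2 := by
    rw [lintegral_tsum fun n => (measurable_const.indicator (hJm n)).aemeasurable]
    refine ENNReal.tsum_le_tsum fun n => ?_
    refine (lintegral_indicator_const_le _ _).trans ?_
    rw [sq]
    gcongr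
    refine (Measure.restrict_apply_le _ _).trans ?_
    rw [hJ]
    simp only [measure_toMeasurable]
    exact volume_image_le_ediam hu _
  exact absurd (h1.trans h2) (not_le.2 hU)

/-- A set of small length is missed by a small sphere around any given point. -/
lemma exists_radius {Y : Type*} [PseudoMetricSpace Y] {L : Set Y} {T : ℕ → Set Y} {η : ℝ}
    (hL : L ⊆ ⋃ n, T n) (hT : ∑' n, Metric.ediam (T n) < ENNReal.ofReal η) (x : Y) :
    ∃ t ∈ Ioo η (2 * η), ∀ y ∈ L, dist y x ≠ t := by
  by_contra! hcon
  have h1 : Ioo η (2 * η) ⊆ ⋃ n, (fun y => dist y x) '' T n := by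
    intro t ht
    obtain ⟨y, hy, hyt⟩ := hcon t ht
    obtain ⟨n, hn⟩ := mem_iUnion.1 (hL hy)
    exact mem_iUnion.2 ⟨n, y, hn, hyt⟩
  have h2 := (measure_mono h1).trans ((measure_iUnion_le (μ := volume) _).trans
    (ENNReal.tsum_le_tsum fun n => volume_image_le_ediam (LipschitzWith.dist_left x) (T n)))
  rw [Real.volume_Ioo, show 2 * η - η = η by ring] at h2
  exact absurd h2 (not_le.2 hT)

/-- A countable clopen cover can be refined to a partition. -/
lemma exists_isLocallyConstant {L α : Type*} [TopologicalSpace L] {V : ℕ → Set L}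
    (hV : ∀ n, IsClopen (V n)) (hcov : ∀ y, ∃ n, y ∈ V n) (c : ℕ → α) :
    ∃ w : L → α, IsLocallyConstant w ∧ ∀ y, ∃ n, y ∈ V n ∧ w y = c n := by
  classical
  refine ⟨fun y => c (Nat.find (hcov y)), ?_, fun y => ⟨_, Nat.find_spec (hcov y), rfl⟩⟩
  refine (IsLocallyConstant.iff_eventually_eq _).2 fun y => ?_
  have h1 : ∀ᶠ z in 𝓝 y, z ∈ V (Nat.find (hcov y)) :=
    (hV _).isOpen.mem_nhds (Nat.find_spec (hcov y))
  have h2 : ∀ᶠ z in 𝓝 y, ∀ m ∈ Finset.range (Nat.find (hcov y)), z ∉ V m :=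
    (Filter.eventually_all_finset _).2 fun m hm =>
      (hV m).compl.isOpen.mem_nhds (Nat.find_min (hcov y) (Finset.mem_range.1 hm))
  filter_upwards [h1, h2] with z hz1 hz2
  congr 1
  exact (Nat.find_eq_iff _).2 ⟨hz1, fun m hm => hz2 m (Finset.mem_range.2 hm)⟩

/-- A map to the plane which is locally close to points of the circle is globally close to a
locally constant map, if it is defined on a set of small length. -/
lemma exists_isLocallyConstant_of_small {Y : Type*} [PseudoMetricSpace Y] {L : Set Y}
    {T : ℕ → Set Y} {η : ℝ} (hL : L ⊆ ⋃ n, T n)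
    (hT : ∑' n, Metric.ediam (T n) < ENNReal.ofReal η) {F : Y → ℂ} {ρ : ℝ}
    (hF : ∀ x ∈ L, ∃ c : Circle, ∀ y ∈ L, dist y x < 2 * η → ‖F y - c‖ < ρ) :
    ∃ w : L → Circle, IsLocallyConstant w ∧ ∀ y : L, ‖F y - w y‖ < ρ := by
  have key : ∀ n, ∃ (V : Set L) (c : Circle), IsClopen V ∧ (∀ y : L, (y : Y) ∈ T n → y ∈ V) ∧
      ∀ y ∈ V, ‖F y - c‖ < ρ := by
    intro n
    by_cases h : ∃ x : L, (x : Y) ∈ T n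
    · obtain ⟨x, hx⟩ := h
      obtain ⟨c, hc⟩ := hF x x.2
      obtain ⟨t, ht, hne⟩ := exists_radius hL hT x
      refine ⟨{y | dist (y : Y) x < t}, c, ⟨?_, ?_⟩, fun y hy => ?_,
        fun y hy => hc y y.2 (lt_trans hy ht.2)⟩
      · have : {y : L | dist (y : Y) x < t} = {y : L | dist (y : Y) x ≤ t} := by
          ext y
          exact ⟨fun h => le_of_lt (show dist (y : Y) x < t from h),
            fun h => lt_of_le_of_ne h (hne y y.2)⟩
        rw [this]
        exact isClosed_le (by fun_prop) continuous_const
      · exact isOpen_lt (by fun_prop) continuous_const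
      · have h1 : edist (y : Y) x < ENNReal.ofReal η :=
          (Metric.edist_le_ediam_of_mem hy hx).trans_lt ((ENNReal.le_tsum n).trans_lt hT)
        have h2 : dist (y : Y) x < η := by
          rw [edist_dist] at h1
          exact (ENNReal.ofReal_lt_ofReal_iff_of_nonneg dist_nonneg).1 h1
        exact lt_trans h2 ht.1
    · exact ⟨∅, 1, isClopen_empty, fun y hy => (h ⟨y, hy⟩).elim, fun y hy => hy.elim⟩
  choose V c hV hTV hc using key
  obtain ⟨w, hw, hwc⟩ := exists_isLocallyConstant hV (fun y => by
    obtain ⟨n, hn⟩ := mem_iUnion.1 (hL y.2)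
    exact ⟨n, hTV n y hn⟩) c
  refine ⟨w, hw, fun y => ?_⟩
  obtain ⟨n, hn, h⟩ := hwc y
  rw [h]
  exact hc n y hn

end Levels

/-! ### Extension of maps to the circle -/

/-- The radial projection of the plane to the circle (with the junk value `1` at `0`). -/
def toCircle (z : ℂ) : Circle := Circle.exp z.arg

lemma coe_toCircle {z : ℂ} (h : z ≠ 0) : (toCircle z : ℂ) = z / ‖z‖ := by
  have h0 : (‖z‖ : ℂ) ≠ 0 := by exact_mod_cast norm_ne_zero_iff.2 h
  rw [toCircle, Circle.coe_exp, eq_div_iff h0, mul_comm, Complex.norm_mul_exp_arg_mul_I]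

lemma continuousOn_toCircle : ContinuousOn toCircle {0}ᶜ := by
  rw [continuousOn_iff_continuous_domRestrict]
  refine continuous_induced_rng.2 ?_
  have : ContinuousOn (fun z : ℂ => z / ‖z‖) {0}ᶜ :=
    continuousOn_id.div (by fun_prop) fun z hz => by simpa using hz
  exact continuousOn_iff_continuous_domRestrict.1 (this.congr fun z hz => coe_toCircle hz)

lemma ne_zero_of_norm_sub_circle_lt {z : ℂ} {c : Circle} (h : ‖z - c‖ < 1) : z ≠ 0 := by
  rintro rfl
  rw [zero_sub, norm_neg, Circle.norm_coe] at h
  exact lt_irrefl _ h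

lemma norm_toCircle_sub_lt {z : ℂ} {c : Circle} (h : ‖z - c‖ < 1 / 2) :
    ‖(toCircle z : ℂ) - c‖ < 1 := by
  have hz : z ≠ 0 := ne_zero_of_norm_sub_circle_lt (h.trans (by norm_num))
  have h0 : ‖z‖ ≠ 0 := norm_ne_zero_iff.2 hz
  have h1 : ‖(toCircle z : ℂ) - z‖ = |1 - ‖z‖| := by
    rw [coe_toCircle hz]
    have : z / ‖z‖ - z = (z / ‖z‖) * ((1 - ‖z‖ : ℝ) : ℂ) := by
      have hz' : (‖z‖ : ℂ) ≠ 0 := by exact_mod_cast h0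
      push_cast
      field_simp
    rw [this, norm_mul, norm_div, Complex.norm_real, Complex.norm_real, norm_norm, div_self h0,
      one_mul, Real.norm_eq_abs]
  have h2 : |1 - ‖z‖| ≤ ‖z - c‖ := by
    have := abs_norm_sub_norm_le (c : ℂ) z
    rwa [Circle.norm_coe, norm_sub_rev] at this
  calc ‖(toCircle z : ℂ) - c‖ ≤ ‖(toCircle z : ℂ) - z‖ + ‖z - c‖ :=
        norm_sub_le_norm_sub_add_norm_sub _ _ _
    _ < 1 := by rw [h1]; linarith

/-- A map to the circle which is close to a locally constant map has a lift to `ℝ`. -/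
lemma exists_lift_of_isLocallyConstant {L : Type*} [TopologicalSpace L] {f w : L → Circle}
    (hf : Continuous f) (hw : IsLocallyConstant w) (h : ∀ y, ‖(f y : ℂ) - w y‖ < 2) :
    ∃ θ : C(L, ℝ), ∀ y, Circle.exp (θ y) = f y := by
  refine ⟨⟨fun y => ((f y / w y : Circle) : ℂ).arg + (w y : ℂ).arg,
    (continuous_arg_div hf hw.continuous h).add
      (hw.comp fun c : Circle => (c : ℂ).arg).continuous⟩, fun y => ?_⟩
  change Circle.exp (_ + _) = f y
  rw [Circle.exp_add, Circle.exp_arg, Circle.exp_arg, div_mul_cancel]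

/-- Averaging extends a uniformly continuous map to the circle, approximately, to a map to the
plane. -/
lemma exists_approx_extension {X : Type*} {Y : Type u} [MetricSpace Y] (ι : X → Y)
    (g : X → Circle) {δ : ℝ} (hδ : 0 < δ)
    (hg : ∀ x x', dist (ι x) (ι x') < δ → ‖(g x : ℂ) - g x'‖ < 1 / 2) :
    ∃ F : C(Y, ℂ), ∀ y x, dist y (ι x) < δ / 4 → ‖F y - g x‖ < 1 / 2 := by
  refine exists_continuous_forall_mem_convex_of_local_const
    (t := fun y => {z : ℂ | ∀ x, dist y (ι x) < δ / 4 → ‖z - g x‖ < 1 / 2}) (fun y => ?_)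
    (fun y₀ => ?_)
  · have : {z : ℂ | ∀ x, dist y (ι x) < δ / 4 → ‖z - g x‖ < 1 / 2} =
        ⋂ (x) (_ : dist y (ι x) < δ / 4), Metric.ball (g x : ℂ) (1 / 2) := by
      ext z
      simp [dist_eq_norm]
    rw [this]
    exact convex_iInter₂ fun x _ => convex_ball _ _
  · have hnear : ∀ᶠ y in 𝓝 y₀, dist y y₀ < δ / 8 := Metric.ball_mem_nhds y₀ (by linarith)
    by_cases h : ∃ x₀, dist y₀ (ι x₀) < δ / 2
    · obtain ⟨x₀, hx₀⟩ := h
      refine ⟨g x₀, ?_⟩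
      filter_upwards [hnear] with y hy x hx
      refine hg x₀ x ?_
      calc dist (ι x₀) (ι x) ≤ dist (ι x₀) y₀ + dist y₀ y + dist y (ι x) := dist_triangle4 _ _ _ _
        _ < δ := by rw [dist_comm (ι x₀), dist_comm y₀ y]; linarith
    · push Not at h
      refine ⟨0, ?_⟩
      filter_upwards [hnear] with y hy x hx
      have := dist_triangle_left y₀ (ι x) y
      linarith [h x]

/-- A uniformly continuous map from a subset of a metric space to the circle extends, up to a
small error, to the whole space if the complement of the subset has small area. -/
theorem exists_extension_to_circle {X : Type*} [Nonempty X] {Y : Type u} [MetricSpace Y]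
    (ι : X → Y) (g : X → Circle) {δ : ℝ} (hδ : 0 < δ)
    (hg : ∀ x x', dist (ι x) (ι x') < δ → ‖(g x : ℂ) - g x'‖ < 1 / 2)
    (hA : area (closure (range ι))ᶜ < ENNReal.ofReal (δ / 16) * ENNReal.ofReal (δ / 8)) :
    ∃ f : C(Y, Circle), ∀ x, ‖(f (ι x) : ℂ) - g x‖ < 1 := by
  classical
  -- `F` is close to `g` within the distance `δ / 4` of `X`; on a level set of the distance `u`
  -- from `X` of small length it has an argument `θ`, and beyond the level set it is replaced by
  -- the exponential of an extension of `θ`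
  obtain ⟨F, hF⟩ := exists_approx_extension ι g hδ hg
  set u : Y → ℝ := fun y => Metric.infDist y (range ι) with hu
  have hne : (range ι).Nonempty := range_nonempty ι
  have hul : LipschitzWith 1 u := Metric.lipschitz_infDist_pt _
  have hclose : ∀ y t, u y < t → ∃ x, dist y (ι x) < t := by
    intro y t ht
    obtain ⟨_, ⟨x, rfl⟩, hx⟩ := (Metric.infDist_lt_iff hne).1 ht
    exact ⟨x, hx⟩
  obtain ⟨U, hU, hUs⟩ := exists_cover_of_area_lt hA
  obtain ⟨s, hs, hsum⟩ := exists_level hul U hUs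
  set L : Set Y := u ⁻¹' {s} with hLdef
  have hLc : IsClosed L := isClosed_singleton.preimage hul.continuous
  have hLU : L ⊆ ⋃ n, U n ∩ u ⁻¹' {s} := by
    intro y hy
    have hy' : y ∈ (closure (range ι))ᶜ := by
      intro h
      have h0 := (Metric.mem_closure_iff_infDist_zero hne).1 h
      have : u y = s := hy
      exact hs.1.ne' (this.symm.trans h0)
    obtain ⟨n, hn⟩ := mem_iUnion.1 (hU hy')
    exact mem_iUnion.2 ⟨n, hn, hy⟩
  obtain ⟨w, hw, hFw⟩ := exists_isLocallyConstant_of_small hLU hsum (F := F) (ρ := 1 / 2) (by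
    intro x hx
    obtain ⟨p, hp⟩ := hclose x (δ / 8) (by rw [show u x = s from hx]; exact hs.2)
    refine ⟨g p, fun y _ hyx => hF y p ?_⟩
    linarith [dist_triangle y x (ι p)])
  have hFne : ∀ y, u y ≤ s → F y ≠ 0 := by
    intro y hy
    obtain ⟨p, hp⟩ := hclose y (δ / 4) (by linarith [hs.2])
    exact ne_zero_of_norm_sub_circle_lt ((hF y p hp).trans (by norm_num))
  have hFc : ContinuousOn (fun y => toCircle (F y)) {y | u y ≤ s} :=
    continuousOn_toCircle.comp F.continuous.continuousOn fun y hy => hFne y hy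
  have hLs : L ⊆ {y | u y ≤ s} := fun y (hy : u y = s) => hy.le
  obtain ⟨θ, hθ⟩ := exists_lift_of_isLocallyConstant
    (continuousOn_iff_continuous_domRestrict.1 (hFc.mono hLs)) hw
    fun y => (norm_toCircle_sub_lt (hFw y)).trans one_lt_two
  obtain ⟨Θ, hΘ⟩ := ContinuousMap.exists_restrict_eq hLc θ
  refine ⟨⟨fun y => if u y ≤ s then toCircle (F y) else Circle.exp (Θ y),
    continuous_if_le hul.continuous continuous_const hFc
      (Circle.exp.continuous.comp Θ.continuous).continuousOn fun y hy => ?_⟩, fun x => ?_⟩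
  · refine ((hθ ⟨y, hy⟩).symm.trans ?_)
    rw [← hΘ]
    rfl
  · have h0 : u (ι x) = 0 := Metric.infDist_zero_of_mem (mem_range_self x)
    simp only [ContinuousMap.coe_mk, h0, hs.1.le, if_true]
    exact norm_toCircle_sub_lt (hF _ _ (by rw [dist_self]; linarith))

/-! ### The excess area bounds the area of the complement -/

lemma area_mono {Y : Type u} [MetricSpace Y] {s t : Set Y} (h : s ⊆ t) : area s ≤ area t := by
  let : MeasurableSpace Y := borel Y
  have : BorelSpace Y := ⟨rfl⟩
  exact measure_mono (μ := Measure.hausdorffMeasure 2) h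

lemma area_sUnion_le {Y : Type u} [MetricSpace Y] {S : Set (Set Y)} (hS : S.Countable) :
    area (⋃₀ S) ≤ ∑' D : S, area (D : Set Y) := by
  let : MeasurableSpace Y := borel Y
  have : BorelSpace Y := ⟨rfl⟩
  rw [sUnion_eq_biUnion]
  exact measure_biUnion_le (Measure.hausdorffMeasure 2) hS id

/-- The covering `Circle.exp` of the circle has no continuous section. -/
lemma not_exists_circle_section (h : C(Circle, ℝ)) : ¬ ∀ z, Circle.exp (h z) = z := by
  intro hz
  have := circle_lift_sub_eq (θ := h.comp Circle.exp) (θ' := ContinuousMap.id ℝ)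
    (fun t => hz (Circle.exp t)) (2 * Real.pi) 0
  simp only [ContinuousMap.comp_apply, Circle.exp_two_pi, Circle.exp_zero, sub_self,
    ContinuousMap.id_apply, sub_zero] at this
  exact Real.two_pi_pos.ne this

/-- A topologically embedded disc has positive area. Otherwise the inverse of the embedding of the
boundary circle would extend, up to a small error, to the disc. -/
lemma area_range_disc_ne_zero {Y : Type u} [MetricSpace Y]
    (k : C(Metric.closedBall (0 : ℂ) 1, Y)) (hk : Function.Injective k) :
    area (range k) ≠ 0 := by
  intro h0
  let bd : C(Circle, Metric.closedBall (0 : ℂ) 1) :=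
    ⟨fun z => ⟨z, by rw [mem_closedBall_zero_iff, Circle.norm_coe]⟩,
      Continuous.subtype_mk continuous_subtype_val fun z => by
        rw [mem_closedBall_zero_iff]
        exact (Circle.norm_coe z).le⟩
  let k' : C(Metric.closedBall (0 : ℂ) 1, range k) := ⟨rangeFactorization k, by fun_prop⟩
  let ι : C(Circle, range k) := k'.comp bd
  have hι : Function.Injective ι := by
    intro z w h
    have h1 : bd z = bd w := hk (congrArg Subtype.val h)
    exact Circle.ext (congrArg (fun b : Metric.closedBall (0 : ℂ) 1 => (b : ℂ)) h1)
  obtain ⟨δ, hδ, hg⟩ : ∃ δ > 0, ∀ z w : Circle, dist (ι z) (ι w) < δ →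
      ‖(z : ℂ) - w‖ < 1 / 2 := by
    have hc : IsCompact {p : Circle × Circle | 1 / 2 ≤ ‖(p.1 : ℂ) - p.2‖} :=
      IsClosed.isCompact (X := Circle × Circle) (isClosed_le continuous_const
        (((continuous_subtype_val.comp continuous_fst).sub
          (continuous_subtype_val.comp continuous_snd)).norm))
    obtain ⟨δ, hδ, h⟩ := hc.exists_forall_le' (f := fun p : Circle × Circle => dist (ι p.1) (ι p.2))
      (by fun_prop) (a := 0) (by
        intro p hp
        refine dist_pos.2 fun heq => ?_
        have h12 := hι heq
        have hp : 1 / 2 ≤ ‖(p.1 : ℂ) - p.2‖ := hp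
        rw [h12, sub_self, norm_zero] at hp
        norm_num at hp)
    refine ⟨δ, hδ, fun z w hzw => ?_⟩
    by_contra! hcon
    exact absurd (h (z, w) hcon) (not_le.2 hzw)
  have hA : area (closure (range ι))ᶜ < ENNReal.ofReal (δ / 16) * ENNReal.ofReal (δ / 8) := by
    have h1 : area (univ : Set (range k)) = 0 := by
      rw [← area_image isometry_subtype_coe, image_univ, Subtype.range_coe, h0]
    refine ((area_mono (subset_univ _)).trans h1.le).trans_lt ?_
    exact ENNReal.mul_pos (ENNReal.ofReal_pos.2 (by linarith)).ne'
      (ENNReal.ofReal_pos.2 (by linarith)).ne'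
  obtain ⟨f, hf⟩ := exists_extension_to_circle ι id hδ hg hA
  have : ContractibleSpace (Metric.closedBall (0 : ℂ) 1) :=
    (convex_closedBall (0 : ℂ) 1).contractibleSpace ⟨0, by simp⟩
  obtain ⟨θ, hθ⟩ := exists_circle_lift (f.comp k')
  have hclose : ∀ z : Circle, ‖(z : ℂ) - f (ι z)‖ < 2 := fun z => by
    rw [norm_sub_rev]
    exact (hf z).trans one_lt_two
  refine not_exists_circle_section ⟨fun z => ((z / f (ι z) : Circle) : ℂ).arg + θ (bd z),
    (continuous_arg_div continuous_id (f.comp ι).continuous hclose).add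
      (θ.comp bd).continuous⟩ fun z => ?_
  change Circle.exp (_ + _) = z
  rw [Circle.exp_add, Circle.exp_arg, hθ]
  exact div_mul_cancel _ _

lemma area_ne_zero_of_homeomorph {Y : Type u} [MetricSpace Y] {D : Set Y}
    {O : Set (EuclideanSpace ℝ (Fin 2))} (e : D ≃ₜ O) {p : EuclideanSpace ℝ (Fin 2)}
    (hp : Metric.closedBall p (1 / 4) ⊆ O) : area D ≠ 0 := by
  -- a closed disc of radius `1 / 4` in `O`, carried over to `D`
  let T := Complex.orthonormalBasisOneI.repr
  have hmem : ∀ z : Metric.closedBall (0 : ℂ) 1, p + (1 / 4 : ℝ) • T z ∈ O := by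
    intro z
    have hz := mem_closedBall_zero_iff.1 z.2
    refine hp ?_
    rw [mem_closedBall_iff_norm, add_sub_cancel_left, norm_smul, T.norm_map]
    norm_num
    linarith
  let k : C(Metric.closedBall (0 : ℂ) 1, Y) :=
    ⟨fun z => (e.symm ⟨p + (1 / 4 : ℝ) • T z, hmem z⟩ : Y), by
      have := T.continuous
      fun_prop⟩
  have hk : Function.Injective k := by
    intro z w h
    have h1 := congrArg Subtype.val (e.symm.injective (Subtype.val_injective h))
    have h2 := smul_right_injective _ (by norm_num : (1 / 4 : ℝ) ≠ 0) (add_left_cancel h1)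
    exact Subtype.ext (T.injective h2)
  intro h0
  refine area_range_disc_ne_zero k hk (le_antisymm ((area_mono ?_).trans h0.le) zero_le)
  rintro _ ⟨z, rfl⟩
  exact Subtype.coe_prop _

/-- The components of the complement in an area extension have positive area. -/
lemma area_component_ne_zero {Y : Type u} [MetricSpace Y] {D : Set Y}
    (h : Nonempty (D ≃ₜ OpenDisc) ∨ Nonempty (D ≃ₜ OpenCylinder)) : area D ≠ 0 := by
  rcases h with ⟨⟨e⟩⟩ | ⟨⟨e⟩⟩
  · refine area_ne_zero_of_homeomorph e (p := 0) fun x hx => ?_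
    have := mem_closedBall_zero_iff.1 hx
    change ‖x‖ < 1
    linarith
  · refine area_ne_zero_of_homeomorph e (p := EuclideanSpace.single 0 (3 / 2)) fun x hx => ?_
    have h1 := mem_closedBall_iff_norm.1 hx
    have h2 : ‖(EuclideanSpace.single 0 (3 / 2) : EuclideanSpace ℝ (Fin 2))‖ = 3 / 2 := by
      rw [PiLp.norm_single]
      norm_num
    have h3 := abs_le.1 (abs_norm_sub_norm_le x (EuclideanSpace.single 0 (3 / 2)))
    rw [h2] at h3
    exact ⟨by linarith [h3.1], by linarith [h3.2]⟩

/-- If the excess area is finite there are only countably many components, as all of them have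
positive area; so the excess area bounds the area of the complement. -/
lemma AreaExtension.area_compl_le {X : Type u} [MetricSpace X] (E : AreaExtension X) :
    area (range E.ι)ᶜ ≤ E.excessArea := by
  by_cases hfin : E.excessArea = ∞
  · rw [hfin]; exact le_top
  have hc : (components (range E.ι)ᶜ).Countable := by
    have h1 := Summable.countable_support_ennreal hfin
    have h2 : (Function.support fun D : components (range E.ι)ᶜ => area (D : Set E.carrier)) =
        univ := eq_univ_of_forall fun D => area_component_ne_zero (E.disc_or_cylinder D D.2)
    rw [h2] at h1
    exact countable_coe_iff.1 (countable_univ_iff.1 h1)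
  refine (area_mono fun y hy => ?_).trans (area_sUnion_le hc)
  exact ⟨_, ⟨y, hy, rfl⟩, mem_connectedComponentIn hy⟩

/-! ### Area extensions of small excess area do not kill homology -/

section Main

variable {X : Type u} [MetricSpace X] [CWComplex (univ : Set X)]

/-- The map which wraps an edge around the circle has Lipschitz constant at most `8` with respect to
the path metric: on the edge of length `1` its speed is `2π`. -/
lemma edist_edgeCircle_le (e : Edge X) (x y : X) :
    edist ((1 / 8 : ℝ) • (edgeCircleFun e x : ℂ)) ((1 / 8 : ℝ) • (edgeCircleFun e y : ℂ)) ≤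
      edgeDist x y := by
  refine le_iSup₂_of_le (PseudoEMetricSpace.induced
    (fun x => (1 / 8 : ℝ) • (edgeCircleFun e x : ℂ)) inferInstance) ?_ le_rfl
  intro e' s hs t ht
  change edist ((1 / 8 : ℝ) • (edgeCircleFun e (RelCWComplex.map 1 e' s) : ℂ))
    ((1 / 8 : ℝ) • (edgeCircleFun e (RelCWComplex.map 1 e' t) : ℂ)) ≤ _
  have hmap : ∀ s ∈ Metric.closedBall (0 : Fin 1 → ℝ) 1, s 0 ∈ Icc (-1 : ℝ) 1 ∧
      RelCWComplex.map 1 e' s = edgeMap e' (s 0) := by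
    intro s hs
    have h : s = fun _ => s 0 := by ext i; rw [Subsingleton.elim i 0]
    have h1 : s 0 ∈ Icc (-1 : ℝ) 1 := const_mem_closedBall.1 (h ▸ hs)
    exact ⟨h1, by rw [edgeMap_of_mem e' h1, ← h]⟩
  rw [(hmap s hs).2, (hmap t ht).2]
  by_cases he : e' = e
  · subst he
    rw [edgeCircleFun_edgeMap_self, edgeCircleFun_edgeMap_self, clamp_of_mem (hmap s hs).1,
      clamp_of_mem (hmap t ht).1]
    refine le_trans ?_ (ENNReal.div_le_div_right (edist_le_pi_edist s t 0) 2)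
    rw [edist_dist, edist_dist, show (2 : ℝ≥0∞) = ENNReal.ofReal 2 by simp,
      ← ENNReal.ofReal_div_of_pos two_pos]
    refine ENNReal.ofReal_le_ofReal ?_
    rw [dist_eq_norm, ← smul_sub, norm_smul, Real.dist_eq]
    have h := Real.norm_exp_I_mul_ofReal_sub_one_le (x := Real.pi * (s 0 - t 0))
    have h2 : ‖(Circle.exp (Real.pi * (1 + s 0)) : ℂ) - Circle.exp (Real.pi * (1 + t 0))‖ ≤
        Real.pi * |s 0 - t 0| := by
      have : (Circle.exp (Real.pi * (1 + s 0)) : ℂ) - Circle.exp (Real.pi * (1 + t 0)) =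
          Circle.exp (Real.pi * (1 + t 0)) *
            (Complex.exp (Complex.I * (Real.pi * (s 0 - t 0) : ℝ)) - 1) := by
        rw [mul_sub, mul_one, Circle.coe_exp, Circle.coe_exp, ← Complex.exp_add]
        congr 2
        push_cast
        ring
      rw [this, norm_mul, Circle.norm_coe, one_mul]
      refine h.trans_eq ?_
      rw [Real.norm_eq_abs, abs_mul, abs_of_pos Real.pi_pos]
    have h3 := Real.pi_le_four
    have h4 := abs_nonneg (s 0 - t 0)
    rw [Real.norm_of_nonneg (by norm_num)]
    nlinarith
  · rw [edgeCircleFun_edgeMap_of_ne he, edgeCircleFun_edgeMap_of_ne he, edist_self]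
    exact zero_le

variable [LocallyFiniteMetricOneComplex X]

variable (X) in
/-- The maps which wrap an edge around the circle are uniformly equicontinuous. -/
lemma exists_dist_lt_imp_edgeCircle :
    ∃ δ : ℝ, 0 < δ ∧ ∀ (e : Edge X) (x y : X), dist x y < δ →
      ‖(edgeCircle e x : ℂ) - edgeCircle e y‖ < 1 / 2 := by
  obtain ⟨δ, hδ, h⟩ := LocallyFiniteMetricOneComplex.uniform (X := X) (ENNReal.ofReal (1 / 16))
    (ENNReal.ofReal_pos.2 (by norm_num))
  obtain ⟨δ', hδ', hlt⟩ := ENNReal.lt_iff_exists_real_btwn.1 hδ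
  have hpos : 0 < δ' := by
    by_contra! hcon
    rw [ENNReal.ofReal_of_nonpos hcon] at hlt
    exact lt_irrefl _ hlt.1
  refine ⟨δ', hpos, fun e x y hxy => ?_⟩
  have h1 : edist x y < δ := by
    rw [edist_dist]
    exact (ENNReal.ofReal_le_ofReal hxy.le).trans_lt hlt.2
  have h2 := (edist_edgeCircle_le e x y).trans_lt (h x y h1)
  rw [edist_dist, ENNReal.ofReal_lt_ofReal_iff (by norm_num), dist_eq_norm, ← smul_sub, norm_smul,
    Real.norm_of_nonneg (by norm_num)] at h2
  change ‖(edgeCircleFun e x : ℂ) - edgeCircleFun e y‖ < 1 / 2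
  linarith

/-- Distinct classes in `H₁` of a locally finite 1-complex have a distance which is bounded from
below: in an area extension of small excess area, each map which wraps an edge around the circle
extends up to homotopy, so the winding numbers of a class around the edges are determined by its
image in the extension. -/
theorem exists_forall_d1_lt_imp_eq (X : Type u) [MetricSpace X] [CWComplex (univ : Set X)]
    [LocallyFiniteMetricOneComplex X] (Γ : Type u) [AddCommGroup Γ] :
    ∃ ε : ℝ≥0∞, 0 < ε ∧ ∀ b c : H1 X Γ, d1 b c < ε → b = c := by
  obtain ⟨δ, hδ, hg⟩ := exists_dist_lt_imp_edgeCircle X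
  refine ⟨ENNReal.ofReal (δ / 16) * ENNReal.ofReal (δ / 8),
    ENNReal.mul_pos (ENNReal.ofReal_pos.2 (by linarith)).ne'
      (ENNReal.ofReal_pos.2 (by linarith)).ne', fun b c hbc => ?_⟩
  rcases isEmpty_or_nonempty X with hX | hX
  · have := H1.subsingleton_of_isEmpty X Γ
    exact Subsingleton.elim b c
  obtain ⟨E, hE⟩ := iInf_lt_iff.1 hbc
  obtain ⟨hEbc, hE⟩ := iInf_lt_iff.1 hE
  rw [← sub_eq_zero]
  refine eq_zero_of_windingHom_edgeCircle _ fun e => ?_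
  have hcl : IsClosed (range E.ι) := E.isometry_ι.isClosedEmbedding.isClosed_range
  obtain ⟨f, hf⟩ := exists_extension_to_circle E.ι (edgeCircle e) hδ
    (fun x y h => hg e x y (by rwa [E.isometry_ι.dist_eq] at h))
    (by rw [hcl.closure_eq]; exact E.area_compl_le.trans_lt hE)
  have h1 : windingHom (edgeCircle e) (b - c) =
      windingHom (f.comp ⟨E.ι, E.isometry_ι.continuous⟩) (b - c) :=
    windingHom_eq_of_norm_sub_lt (fun x => by
      rw [norm_sub_rev]
      exact (hf x).trans one_lt_two) _
  have h2 : H1.map Γ ⟨E.ι, E.isometry_ι.continuous⟩ (b - c) = 0 := by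
    rw [map_sub, sub_eq_zero]
    exact hEbc
  rw [h1, ← windingHom_map, h2, map_zero]

/-- The canonical map to the completion, as a homomorphism. -/
def toHdHatHom (X : Type u) [MetricSpace X] [CompleteSpace X] (Γ : Type u) [AddCommGroup Γ] :
    H1 X Γ →+ HdHat X Γ where
  toFun := toHdHat
  map_zero' := by rfl
  map_add' a b := by
    rw [toHdHat, SeparationQuotient.mk_add, UniformSpace.Completion.coe_add]
    rfl

/-- Since `d₁` is bounded from below on pairs of distinct classes, neither the identification of
classes at distance zero nor the completion changes `H₁`. -/
lemma toHdHat_bijective (X : Type u) [MetricSpace X] [CWComplex (univ : Set X)]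
    [LocallyFiniteMetricOneComplex X] (Γ : Type u) [AddCommGroup Γ] :
    Function.Bijective (toHdHat (X := X) (Γ := Γ)) := by
  obtain ⟨ε, hε, h⟩ := exists_forall_d1_lt_imp_eq X Γ
  have hsep : ∀ a b : Hd X Γ, edist a b < ε → a = b := by
    intro a b
    obtain ⟨a, rfl⟩ := SeparationQuotient.surjective_mk a
    obtain ⟨b, rfl⟩ := SeparationQuotient.surjective_mk b
    intro hab
    rw [h a b hab]
  have hcomplete : CompleteSpace (Hd X Γ) := by
    refine EMetric.complete_of_cauchySeq_tendsto fun u hu => ?_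
    obtain ⟨N, hN⟩ := EMetric.cauchySeq_iff.1 hu ε hε
    refine ⟨u N, tendsto_const_nhds.congr' ?_⟩
    filter_upwards [Filter.eventually_ge_atTop N] with n hn
    exact hsep _ _ (hN N le_rfl n hn)
  have hcoe : Function.Bijective ((↑) : Hd X Γ → HdHat X Γ) := by
    refine ⟨UniformSpace.Completion.coe_injective _, ?_⟩
    rw [← range_eq_univ]
    have hcl := (UniformSpace.Completion.isUniformEmbedding_coe (Hd X Γ)).isClosedEmbedding
    rw [← hcl.isClosed_range.closure_eq]
    exact UniformSpace.Completion.denseRange_coe.closure_range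
  refine hcoe.comp ⟨fun a b hab => h a b ?_, SeparationQuotient.surjective_mk⟩
  have h0 : edist (SeparationQuotient.mk a) (SeparationQuotient.mk b) = 0 := by
    rw [hab, edist_self]
  exact lt_of_eq_of_lt h0 hε

end Main

end LengthHomology

end

theorem corollary6p2 {X : Type u} [MetricSpace X] [Topology.CWComplex (Set.univ : Set X)]
    [LengthHomology.LocallyFiniteMetricOneComplex X] (Γ : Type u) [AddCommGroup Γ] :
    ∃ φ : LengthHomology.HdHat X Γ ≃+ LengthHomology.H1 X Γ,
      ∀ c : LengthHomology.H1 X Γ, φ (LengthHomology.toHdHat c) = c := by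
  have hb : Function.Bijective (LengthHomology.toHdHatHom X Γ) :=
    LengthHomology.toHdHat_bijective X Γ
  exact ⟨(AddEquiv.ofBijective (LengthHomology.toHdHatHom X Γ) hb).symm, fun c =>
    (AddEquiv.ofBijective (LengthHomology.toHdHatHom X Γ) hb).symm_apply_apply c⟩
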